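/- Let $k$ be a field, let $n\ge 1$, and let $\Pi=\Pi_{A_n}$ be the preprojective algebra of type $A_n$ over $k$, that is, the path algebra $k\overline Q$ of the double quiver $\overline Q$ of $Q\colon 1\to 2\to\cdots\to n$ (each arrow $a$ of $Q$ gets a reversed arrow $a^*$) modulo the two-sided ideal generated by $\sum_{a\in Q_1}(aa^*-a^*a)$. Let $I_{\mathrm{cyc}}$ be the two-sided ideal of $\Pi$ generated by all 2-cycles of $\overline Q$, and let $\overline\Pi=\Pi/I_{\mathrm{cyc}}$. For a finite-dimensional $k$-algebra $A$, let $\mathrm{Ideals}\,A$ be the lattice of two-sided ideals of $A$ ordered by inclusion, $\mathrm{mod}\,A$ the category of finitely generated left $A$-modules, and $\mathrm{tors}\,A$ the complete lattice, ordered by inclusion, of torsion classes of $\mathrm{mod}\,A$ (classes that contain $0$ and are closed under isomorphisms, factor modules and extensions). For $I\in\mathrm{Ideals}\,A$, let $\eta_A(I)$ be the complete lattice congruence on $\mathrm{tors}\,A$ for which $\mathcal T\equiv\mathcal U$ if and only if $\mathcal T\cap\mathrm{mod}(A/I)=\mathcal U\cap\mathrm{mod}(A/I)$, where $\mathrm{mod}(A/I)$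 is identified with the class of the modules in $\mathrm{mod}\,A$ that are annihilated by $I$. Let $\mathrm{AlgCon}\,A$ be the image of $\eta_A$, ordered by refinement. A brick is a module in $\mathrm{mod}\,A$ whose endomorphism ring is a division ring. Let $\mathscr U$ be the set of paths of $\overline Q$, trivial paths included, that visit each vertex at most once, partially ordered by $w\le w'$ if $w$ is a subpath of $w'$; elements of $\mathscr U$ are also regarded as elements of $\Pi$ and of $\overline\Pi$. Let $\mathrm{Ideals}\,\mathscr U$ be the set, ordered by inclusion, of the subsets $\mathcal S\subseteq\mathscr U$ such that $w\in\mathcal S$ and $w\le w'$ imply $w'\in\mathcal S$. Then the following hold. (a) The ideal $I_0=\bigcap_{S}\mathrm{ann}\,S$ of $\Pi$, where $S$ runs over all bricks of $\mathrm{mod}\,\Pi$, equals $I_{\mathrm{cyc}}$. (b) The map $\mathcal S\mapsto\mathrm{span}_k\,\mathcal S$ is a lattice isomorphism $\mathrm{Ideals}\,\mathscr U\to\mathrm{Ideals}\,\overline\Pi$. The map $\mathcal T\mapsto\mathcal T\cap\mathrm{mod}\,\overline\Pi$ is a lattice isomorphism $\mathrm{tors}\,\Pi\to\mathrm{tors}\,\overline\Pi$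 and, when $\mathrm{tors}\,\Pi$ and $\mathrm{tors}\,\overline\Pi$ are identified by it, $I\mapsto\eta_{\overline\Pi}(I)$ is a lattice isomorphism $\mathrm{Ideals}\,\overline\Pi\to\mathrm{AlgCon}\,\Pi$. (c) For all $I,J\in\mathrm{Ideals}\,\Pi$, the following are equivalent: $\eta_\Pi(I)=\eta_\Pi(J)$; $\eta_{\overline\Pi}(\overline I)=\eta_{\overline\Pi}(\overline J)$, where $\overline I=(I+I_{\mathrm{cyc}})/I_{\mathrm{cyc}}$ and $\overline J=(J+I_{\mathrm{cyc}})/I_{\mathrm{cyc}}$; $I+I_{\mathrm{cyc}}=J+I_{\mathrm{cyc}}$; $I\cap\mathscr U=J\cap\mathscr U$. -/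

import Mathlib

universe u v

/-! ### Complete lattice congruences -/

/-- A complete congruence on a complete lattice `L`: an equivalence relation compatible with
arbitrary meets and joins. (Index types in the universe of `L` are enough: a family of pairs of
elements of `L` can be reindexed by its range in `L × L`.) -/
structure CompleteCongruence (L : Type v) [CompleteLattice L] extends Setoid L where
  iInf_rel : ∀ {ι : Type v} {x y : ι → L}, (∀ i, r (x i) (y i)) → r (⨅ i, x i) (⨅ i, y i)
  iSup_rel : ∀ {ι : Type v} {x y : ι → L}, (∀ i, r (x i) (y i)) → r (⨆ i, x i) (⨆ i, y i)

namespace CompleteCongruence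

variable {L : Type v} [CompleteLattice L]

theorem toSetoid_injective :
    Function.Injective (toSetoid : CompleteCongruence L → Setoid L) := by
  rintro ⟨s, _, _⟩ ⟨t, _, _⟩ h
  cases h
  rfl

/-- Congruences are ordered by refinement: `Θ ≤ Θ'` iff `x ≡_Θ y` implies `x ≡_Θ' y`. -/
instance instPartialOrder : PartialOrder (CompleteCongruence L) :=
  PartialOrder.lift toSetoid toSetoid_injective

end CompleteCongruence

/-! ### Torsion classes of finitely generated left modules -/

/-- A torsion class in the category of finitely generated left `A`-modules: a class of finitely
generated modules that contains the zero modules and is closed under factor modules (hence under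
isomorphisms) and extensions. -/
@[ext]
structure TorsionClass (A : Type u) [Ring A] where
  carrier : Set (ModuleCat.{u} A)
  finite : ∀ M ∈ carrier, Module.Finite A M
  zero_mem : ∀ M : ModuleCat.{u} A, Subsingleton M → M ∈ carrier
  factor_mem : ∀ (M N : ModuleCat.{u} A) (f : M →ₗ[A] N),
    Function.Surjective f → M ∈ carrier → N ∈ carrier
  ext_mem : ∀ (K M N : ModuleCat.{u} A) (f : K →ₗ[A] M) (g : M →ₗ[A] N),
    Function.Injective f → Function.Exact f g → Function.Surjective g →
      K ∈ carrier → N ∈ carrier → M ∈ carrier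

namespace TorsionClass

variable {A : Type u} [Ring A]

/-- Torsion classes are ordered by inclusion. -/
instance instPartialOrder : PartialOrder (TorsionClass A) :=
  PartialOrder.lift carrier fun _ _ h => TorsionClass.ext h

/-- The intersection of a set of torsion classes (the class of all finitely generated modules if
the set is empty). -/
instance instInfSet : InfSet (TorsionClass A) where
  sInf S :=
    { carrier := {M | Module.Finite A M ∧ ∀ T ∈ S, M ∈ T.carrier}
      finite := fun _ h => h.1
      zero_mem := fun M hM => ⟨inferInstance, fun T _ => T.zero_mem M hM⟩
      factor_mem := fun M N f hf h =>
        ⟨haveI := h.1; Module.Finite.of_surjective f hf,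
          fun T hT => T.factor_mem M N f hf (h.2 T hT)⟩
      ext_mem := fun K M N f g hf hfg hg hK hN =>
        ⟨haveI := hK.1; haveI := hN.1; Module.Finite.of_exact hfg hg,
          fun T hT => T.ext_mem K M N f g hf hfg hg (hK.2 T hT) (hN.2 T hT)⟩ }

theorem isGLB_sInf (S : Set (TorsionClass A)) : IsGLB S (sInf S) :=
  ⟨fun T hT _ hM => hM.2 T hT, fun U hU M hM => ⟨U.finite M hM, fun _ hT => hU hT hM⟩⟩

/-- The complete lattice of torsion classes: meets are intersections. -/
instance instCompleteLattice : CompleteLattice (TorsionClass A) :=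
  completeLatticeOfInf (TorsionClass A) isGLB_sInf

theorem mem_iInf {ι : Type*} {T : ι → TorsionClass A} {M : ModuleCat.{u} A} :
    M ∈ (⨅ i, T i).carrier ↔ Module.Finite A M ∧ ∀ i, M ∈ (T i).carrier := by
  constructor
  · rintro ⟨h, h'⟩
    exact ⟨h, fun i => h' _ ⟨i, rfl⟩⟩
  · rintro ⟨h, h'⟩
    refine ⟨h, ?_⟩
    rintro _ ⟨i, rfl⟩
    exact h' i

/-- For a surjective ring morphism `φ : A → B`, the torsion class `T ∩ mod B` of `B`-modules, where
a `B`-module is regarded as an `A`-module through `φ`. -/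
def restrict {B : Type u} [Ring B] (φ : A →+* B) (T : TorsionClass A) : TorsionClass B where
  carrier := {N | Module.Finite B N ∧ (ModuleCat.restrictScalars φ).obj N ∈ T.carrier}
  finite := fun _ h => h.1
  zero_mem := fun _ hM => ⟨inferInstance, T.zero_mem _ hM⟩
  factor_mem := fun _ _ f hf h =>
    ⟨haveI := h.1; Module.Finite.of_surjective f hf,
      T.factor_mem _ _ ((ModuleCat.restrictScalars φ).map (ModuleCat.ofHom f)).hom hf h.2⟩
  ext_mem := fun _ _ _ f g hf hfg hg hK hN =>
    ⟨haveI := hK.1; haveI := hN.1; Module.Finite.of_exact hfg hg,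
      T.ext_mem _ _ _ ((ModuleCat.restrictScalars φ).map (ModuleCat.ofHom f)).hom
        ((ModuleCat.restrictScalars φ).map (ModuleCat.ofHom g)).hom hf hfg hg hK.2 hN.2⟩

end TorsionClass

/-! ### Algebraic congruences -/

/-- `M` is annihilated by `I`, that is, `M` is a module over `A / I`. -/
def AnnihilatedBy {A : Type u} [Ring A] (I : TwoSidedIdeal A) (M : ModuleCat.{u} A) : Prop :=
  ∀ a ∈ I, ∀ m : M, a • m = 0

namespace TorsionClass

variable {A : Type u} [Ring A]

/-- The class of the finitely generated modules all of whose factor modules over `A / I` lie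
in `T`; it is used to see that `T ↦ T ∩ mod (A / I)` is compatible with joins. -/
def lift (I : TwoSidedIdeal A) (T : TorsionClass A) : TorsionClass A where
  carrier := {M | Module.Finite A M ∧ ∀ (Q : ModuleCat.{u} A) (q : M →ₗ[A] Q),
    Function.Surjective q → AnnihilatedBy I Q → Q ∈ T.carrier}
  finite := fun _ h => h.1
  zero_mem := fun M hM =>
    ⟨inferInstance, fun Q q hq _ => T.factor_mem M Q q hq (T.zero_mem M hM)⟩
  factor_mem := fun M N f hf h =>
    ⟨haveI := h.1; Module.Finite.of_surjective f hf,
      fun Q q hq hQ => h.2 Q (q ∘ₗ f) (hq.comp hf) hQ⟩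
  ext_mem := fun K M N f g hf hfg hg hK hN => by
    refine ⟨haveI := hK.1; haveI := hN.1; Module.Finite.of_exact hfg hg, fun Q q hq hQ => ?_⟩
    let R : Submodule A Q := LinearMap.range (q ∘ₗ f)
    have hker : LinearMap.ker g ≤ LinearMap.ker (R.mkQ ∘ₗ q) := by
      intro m hm
      obtain ⟨x, rfl⟩ := (hfg m).1 hm
      exact (Submodule.Quotient.mk_eq_zero R).2 ⟨x, rfl⟩
    let e := (LinearMap.quotKerEquivOfSurjective g hg).symm
    let s : N →ₗ[A] Q ⧸ R := ((LinearMap.ker g).liftQ (R.mkQ ∘ₗ q) hker) ∘ₗ e.toLinearMap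
    have hs : Function.Surjective s := by
      intro z
      obtain ⟨y, rfl⟩ := R.mkQ_surjective z
      obtain ⟨m, rfl⟩ := hq y
      refine ⟨g m, ?_⟩
      have : e (g m) = (LinearMap.ker g).mkQ m := by
        rw [LinearEquiv.symm_apply_eq]
        rfl
      simp [s, this]
    have h1 : ModuleCat.of A R ∈ T.carrier :=
      hK.2 (ModuleCat.of A R) (LinearMap.rangeRestrict (q ∘ₗ f))
        (LinearMap.surjective_rangeRestrict _) fun a ha m => Subtype.ext (hQ a ha m.1)
    have h2 : ModuleCat.of A (Q ⧸ R) ∈ T.carrier := by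
      refine hN.2 (ModuleCat.of A (Q ⧸ R)) s hs fun a ha z => ?_
      obtain ⟨y, rfl⟩ := R.mkQ_surjective z
      change a • R.mkQ y = 0
      rw [← map_smul, hQ a ha y, map_zero]
    exact T.ext_mem (ModuleCat.of A R) Q (ModuleCat.of A (Q ⧸ R)) R.subtype R.mkQ
      R.injective_subtype (LinearMap.exact_subtype_mkQ R) R.mkQ_surjective h1 h2

theorem mem_iSup_of_rel (I : TwoSidedIdeal A) {ι : Type*} {T U : ι → TorsionClass A}
    (h : ∀ i (M : ModuleCat.{u} A), AnnihilatedBy I M →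
      (M ∈ (T i).carrier ↔ M ∈ (U i).carrier))
    {M : ModuleCat.{u} A} (hI : AnnihilatedBy I M) (hM : M ∈ (⨆ i, T i).carrier) :
    M ∈ (⨆ i, U i).carrier := by
  have hle : ⨆ i, T i ≤ lift I (⨆ i, U i) := iSup_le fun i N hN =>
    ⟨(T i).finite N hN, fun Q q hq hQ =>
      le_iSup U i ((h i Q hQ).1 ((T i).factor_mem N Q q hq hN))⟩
  exact (hle hM).2 M LinearMap.id Function.surjective_id hI

end TorsionClass

/-- The map `η_A : I ↦ Θ_I`, where `T ≡ U` for `Θ_I` if and only if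
`T ∩ mod (A / I) = U ∩ mod (A / I)`. -/
def eta {A : Type u} [Ring A] (I : TwoSidedIdeal A) : CompleteCongruence (TorsionClass A) where
  r T U := ∀ M : ModuleCat.{u} A, AnnihilatedBy I M → (M ∈ T.carrier ↔ M ∈ U.carrier)
  iseqv :=
    ⟨fun _ _ _ => Iff.rfl, fun h M hM => (h M hM).symm,
      fun h h' M hM => (h M hM).trans (h' M hM)⟩
  iInf_rel := fun h M hM => by
    simp only [TorsionClass.mem_iInf]
    exact and_congr_right fun _ => forall_congr' fun i => h i M hM
  iSup_rel := fun h M hM =>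
    ⟨TorsionClass.mem_iSup_of_rel I h hM,
      TorsionClass.mem_iSup_of_rel I (fun i N hN => (h i N hN).symm) hM⟩

/-- The poset of algebraic congruences: the image of `η_A`, ordered by refinement. -/
abbrev AlgCon (A : Type u) [Ring A] : Type (u + 1) :=
  {Θ : CompleteCongruence (TorsionClass A) // Θ ∈ Set.range (eta (A := A))}

/-! ### Bricks -/

/-- A brick: a finitely generated module whose endomorphism ring is a division ring. -/
def IsBrick (A : Type u) [Ring A] (S : ModuleCat.{u} A) : Prop :=
  Module.Finite A S ∧ Nontrivial (Module.End A S) ∧ ∀ f : Module.End A S, f ≠ 0 → IsUnit f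

/-- The ideal `I₀`: the intersection of the annihilators of all bricks. -/
def brickIdeal (A : Type u) [Ring A] : TwoSidedIdeal A :=
  TwoSidedIdeal.mk' {a | ∀ S : ModuleCat.{u} A, IsBrick A S → ∀ s : S, a • s = 0}
    (fun _ _ s => zero_smul A s)
    (fun hx hy S hS s => by rw [add_smul, hx S hS s, hy S hS s, add_zero])
    (fun hx S hS s => by rw [neg_smul, hx S hS s, neg_zero])
    (fun hy S hS s => by rw [mul_smul, hy S hS s, smul_zero])
    (fun hx S hS s => by rw [mul_smul, hx S hS])

/-! ### Path algebras and preprojective algebras -/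

namespace PathAlgebra

/-- The generators of the path algebra of a quiver: its vertices and its arrows. -/
inductive Gen (V : Type) [Quiver.{0} V] : Type
  | vertex (i : V) : Gen V
  | arrow {i j : V} (a : i ⟶ j) : Gen V

/-- The defining relations of the path algebra of a finite quiver: the vertices `e_i` form a
complete system of orthogonal idempotents, and `e_i a = a = a e_j` for an arrow `a : i → j`.
Paths are composed from left to right. -/
inductive Rel (k : Type u) [Field k] (V : Type) [Quiver.{0} V] [Fintype V] :
    FreeAlgebra k (Gen V) → FreeAlgebra k (Gen V) → Prop
  | idem (i : V) : Rel k V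
      (FreeAlgebra.ι k (Gen.vertex i) * FreeAlgebra.ι k (Gen.vertex i))
      (FreeAlgebra.ι k (Gen.vertex i))
  | orth (i j : V) (h : i ≠ j) : Rel k V
      (FreeAlgebra.ι k (Gen.vertex i) * FreeAlgebra.ι k (Gen.vertex j)) 0
  | sum_eq_one : Rel k V (∑ i : V, FreeAlgebra.ι k (Gen.vertex i)) 1
  | source {i j : V} (a : i ⟶ j) : Rel k V
      (FreeAlgebra.ι k (Gen.vertex i) * FreeAlgebra.ι k (Gen.arrow a))
      (FreeAlgebra.ι k (Gen.arrow a))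
  | target {i j : V} (a : i ⟶ j) : Rel k V
      (FreeAlgebra.ι k (Gen.arrow a) * FreeAlgebra.ι k (Gen.vertex j))
      (FreeAlgebra.ι k (Gen.arrow a))

end PathAlgebra

/-- The path algebra of a finite quiver over a field. -/
abbrev PathAlgebra (k : Type u) [Field k] (V : Type) [Quiver.{0} V] [Fintype V] : Type u :=
  RingQuot (PathAlgebra.Rel k V)

namespace PathAlgebra

variable (k : Type u) [Field k] {V : Type} [Quiver.{0} V] [Fintype V]

/-- The idempotent `e_i` of a vertex. -/
noncomputable def vertex (i : V) : PathAlgebra k V :=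
  RingQuot.mkAlgHom k (Rel k V) (FreeAlgebra.ι k (Gen.vertex i))

/-- The element of the path algebra given by an arrow. -/
noncomputable def arrow {i j : V} (a : i ⟶ j) : PathAlgebra k V :=
  RingQuot.mkAlgHom k (Rel k V) (FreeAlgebra.ι k (Gen.arrow a))

/-- The element of the path algebra given by a path. -/
noncomputable def ofPath {i : V} : ∀ {j : V}, Quiver.Path i j → PathAlgebra k V
  | _, Quiver.Path.nil => vertex k i
  | _, Quiver.Path.cons p a => ofPath p * arrow k a

end PathAlgebra

instance symmetrifyFintype (V : Type) [Fintype V] : Fintype (Quiver.Symmetrify V) :=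
  inferInstanceAs (Fintype V)

/-- The relation `∑ (a a* - a* a) = 0` of the preprojective algebra; the sum runs over the arrows
`a` of the quiver `V`, and `a*` is the reversed arrow in the double quiver. -/
inductive PreprojRel (k : Type u) [Field k] (V : Type) [Quiver.{0} V] [Fintype V]
    [∀ i j : V, Fintype (i ⟶ j)] :
    PathAlgebra k (Quiver.Symmetrify V) → PathAlgebra k (Quiver.Symmetrify V) → Prop
  | rel : PreprojRel k V
      (∑ i : V, ∑ j : V, ∑ a : i ⟶ j,
        (PathAlgebra.arrow k a.toPos * PathAlgebra.arrow k a.toNeg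
          - PathAlgebra.arrow k a.toNeg * PathAlgebra.arrow k a.toPos)) 0

/-- The preprojective algebra of a finite quiver. -/
abbrev Preprojective (k : Type u) [Field k] (V : Type) [Quiver.{0} V] [Fintype V]
    [∀ i j : V, Fintype (i ⟶ j)] : Type u :=
  RingQuot (PreprojRel k V)

/-! ### Non-revisiting paths -/

/-- A path of a quiver that visits each vertex at most once (trivial paths included). -/
structure NonRevisitingPath (V : Type) [Quiver.{0} V] where
  source : V
  target : V
  path : Quiver.Path source target
  nodup : path.vertices.Nodup

namespace NonRevisitingPath

variable {V : Type} [Quiver.{0} V]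

/-- `p ≤ q` if `p` is a subpath of `q`. -/
instance instPartialOrder : PartialOrder (NonRevisitingPath V) where
  le p q := ∃ (b : Quiver.Path q.source p.source) (c : Quiver.Path p.target q.target),
    q.path = b.comp (p.path.comp c)
  le_refl p := ⟨Quiver.Path.nil, Quiver.Path.nil, by simp⟩
  le_trans p q r := by
    rintro ⟨b, c, h⟩ ⟨b', c', h'⟩
    exact ⟨b'.comp b, c.comp c', by rw [h', h]; simp only [Quiver.Path.comp_assoc]⟩
  le_antisymm p q := by
    rintro ⟨b, c, h⟩ ⟨b', c', h'⟩
    obtain ⟨s, t, p, hp⟩ := p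
    obtain ⟨s', t', q, hq⟩ := q
    dsimp only at b c h b' c' h'
    have e := congrArg Quiver.Path.length h
    have e' := congrArg Quiver.Path.length h'
    simp only [Quiver.Path.length_comp] at e e'
    have hb : b.length = 0 := by omega
    have hc : c.length = 0 := by omega
    obtain rfl := Quiver.Path.eq_of_length_zero b hb
    obtain rfl := Quiver.Path.eq_of_length_zero c hc
    obtain rfl := Quiver.Path.eq_nil_of_length_zero b hb
    obtain rfl := Quiver.Path.eq_nil_of_length_zero c hc
    simp only [Quiver.Path.nil_comp, Quiver.Path.comp_nil] at h
    subst h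
    rfl

end NonRevisitingPath

/-! ### Type `A` -/

/-- The vertices of the quiver `1 → 2 → ⋯ → n` of type `A_n` (numbered from `0`). A type synonym
is used because `Fin n` already carries the quiver of its order. -/
def TypeA (n : ℕ) : Type := Fin n

instance TypeA.instFintype (n : ℕ) : Fintype (TypeA n) := inferInstanceAs (Fintype (Fin n))

instance TypeA.instDecidableEq (n : ℕ) : DecidableEq (TypeA n) := inferInstanceAs (DecidableEq (Fin n))

/-- The number of a vertex. -/
def TypeA.val {n : ℕ} (i : TypeA n) : ℕ := Fin.val i

/-- One arrow `i → i + 1` for each vertex `i` but the last. -/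
instance TypeA.instQuiver (n : ℕ) : Quiver.{0} (TypeA n) where
  Hom i j := PLift (i.val + 1 = j.val)

instance TypeA.instFintypeHom {n : ℕ} (i j : TypeA n) : Fintype (i ⟶ j) :=
  inferInstanceAs (Fintype (PLift (i.val + 1 = j.val)))

/-- The preprojective algebra `Π` of type `A_n`. -/
abbrev PiA (k : Type u) [Field k] (n : ℕ) : Type u := Preprojective k (TypeA n)

/-- The poset `𝒰` of non-revisiting paths in the quiver of `Π`. -/
abbrev PathsA (n : ℕ) : Type := NonRevisitingPath (Quiver.Symmetrify (TypeA n))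

namespace PiA

variable (k : Type u) [Field k] (n : ℕ)

/-- The element of `Π` given by an arrow of the double quiver. -/
noncomputable def arrow {i j : Quiver.Symmetrify (TypeA n)} (a : i ⟶ j) : PiA k n :=
  RingQuot.mkAlgHom k (PreprojRel k (TypeA n)) (PathAlgebra.arrow k a)

/-- The element of `Π` given by a non-revisiting path. -/
noncomputable def ofPath (p : PathsA n) : PiA k n :=
  RingQuot.mkAlgHom k (PreprojRel k (TypeA n)) (PathAlgebra.ofPath k p.path)

/-- The two-sided ideal `I_cyc` generated by all 2-cycles. -/
noncomputable def cycIdeal : TwoSidedIdeal (PiA k n) :=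
  TwoSidedIdeal.span {z | ∃ (i j : Quiver.Symmetrify (TypeA n)) (a : i ⟶ j) (b : j ⟶ i),
    z = arrow k n a * arrow k n b}

end PiA

/-- The algebra `Π / I_cyc`. -/
abbrev PiABar (k : Type u) [Field k] (n : ℕ) : Type u := (PiA.cycIdeal k n).ringCon.Quotient

/-- The canonical surjection `Π → Π / I_cyc`. -/
noncomputable abbrev PiA.toBar (k : Type u) [Field k] (n : ℕ) : PiA k n →+* PiABar k n :=
  (PiA.cycIdeal k n).ringCon.mk'

/-! Everything rests on one element, the sum `c` of the 2-cycles `a a*`. The preprojective relation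
says that `c` is also the sum of the `a* a`, so each 2-cycle at a vertex `i` equals both `e_i c` and
`c e_i`. Hence `c` is central and `I_cyc = cΠ`. Pushing `e_i c` down towards the first vertex, where
it is zero, shows that `c` is nilpotent.

Nilpotence makes `I_cyc` invisible to torsion classes. A module `M` is filtered by the `c^r M`, each
of them a factor of `M`, so `M` lies in a torsion class as soon as its factors killed by `c` do
(`mem_of_forall_factor`). This identifies the torsion classes of `Π` with those of `Π / I_cyc`, and
shows that adding `I_cyc` to an ideal does not change its congruence (`eta_sup_eq`).

In type `A` there is exactly one non-revisiting path between any two vertices, the shortest one, and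
every path is a shortest path times a power of `c` (`exists_word_eq`). So each `e_i (Π / I_cyc) e_j`
is a line, and an ideal containing `I_cyc` is determined by the shortest paths in it
(`mem_iff_of_cycIdeal_le`). Linear independence of these paths comes from the representations `rep`,
whose matrix entries are the coefficients `coord`.

The same representations give uniserial bricks, one for each pair `(i, j)`. For an ideal `J`
containing `I_cyc`, this brick is killed by `J` exactly when the path from `i` to `j` is not in `J`.
On any brick `c` acts by a nilpotent endomorphism, hence by zero; with the uniserial bricks this
yields (a). A brick killed by `J` but not by `I` separates the two congruences
(`IsBrick.annihilatedBy_of_eta_le`), so the congruence recovers the ideal of `Π / I_cyc`. For (c), a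
shortest path in `I + I_cyc` is already in `I`, because up to an element of `I` it is a multiple of
itself by a nilpotent element (`mem_of_add_central_mul_eq`). -/

/-! ### Modules over a quotient ring -/

/-- A module over the source of a surjective ring morphism that is annihilated by the kernel comes
from a module over the target. -/
theorem exists_restrictScalars_equiv {A B : Type u} [Ring A] [Ring B] (φ : A →+* B)
    (hφ : Function.Surjective φ) (M : ModuleCat.{u} A) (hM : ∀ a, φ a = 0 → ∀ m : M, a • m = 0) :
    ∃ N : ModuleCat.{u} B, Nonempty ((ModuleCat.restrictScalars φ).obj N ≃ₗ[A] M) := by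
  let _ : SMul B M := ⟨fun b m => Function.surjInv hφ b • m⟩
  have hs : ∀ (a : A) (m : M), φ a • m = a • m := fun a m => by
    have h := hM (Function.surjInv hφ (φ a) - a)
      (by rw [map_sub, Function.surjInv_eq hφ, sub_self]) m
    rw [sub_smul, sub_eq_zero] at h
    exact h
  let _ : Module B M := Function.Surjective.moduleLeft φ hφ hs
  exact ⟨ModuleCat.of B M, ⟨{ AddEquiv.refl M with map_smul' := fun a m => hs a m }⟩⟩

theorem finite_restrictScalars_iff {A B : Type u} [Ring A] [Ring B] (φ : A →+* B)
    (hφ : Function.Surjective φ) (N : ModuleCat.{u} B) :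
    Module.Finite A ((ModuleCat.restrictScalars φ).obj N) ↔ Module.Finite B N := by
  let _ : RingHomSurjective φ := ⟨hφ⟩
  let l : (ModuleCat.restrictScalars φ).obj N →ₛₗ[φ] N :=
    { toFun := fun x => x, map_add' := fun _ _ => rfl, map_smul' := fun _ _ => rfl }
  constructor
  · intro h
    exact Module.Finite.of_surjective l Function.surjective_id
  · rintro ⟨s, hs⟩
    let s' : Finset ((ModuleCat.restrictScalars φ).obj N) := s
    have key (y : N) (hy : y ∈ Submodule.span B (s : Set N)) :
        (show (ModuleCat.restrictScalars φ).obj N from y) ∈ Submodule.span A (s' : Set _) := by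
      induction hy using Submodule.span_induction with
      | mem x h => exact Submodule.subset_span h
      | zero => exact Submodule.zero_mem _
      | add x y _ _ hx hy => exact Submodule.add_mem _ hx hy
      | smul b x _ hx =>
        obtain ⟨a, rfl⟩ := hφ b
        exact Submodule.smul_mem _ a hx
    exact ⟨s', eq_top_iff.2 fun x _ => key x (hs ▸ Submodule.mem_top)⟩

theorem exists_comp_eq_of_exact {A : Type*} [Ring A] {K M N S : Type*} [AddCommGroup K]
    [AddCommGroup M] [AddCommGroup N] [AddCommGroup S] [Module A K] [Module A M] [Module A N]
    [Module A S] {f : K →ₗ[A] M} {g : M →ₗ[A] N} (hfg : Function.Exact f g)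
    (hg : Function.Surjective g) (t : M →ₗ[A] S) (h : t ∘ₗ f = 0) : ∃ s : N →ₗ[A] S, s ∘ₗ g = t := by
  have hker : LinearMap.ker g ≤ LinearMap.ker t := by
    intro m hm
    obtain ⟨x, rfl⟩ := (hfg m).1 hm
    exact LinearMap.congr_fun h x
  refine ⟨(LinearMap.ker g).liftQ t hker ∘ₗ
    (LinearMap.quotKerEquivOfSurjective g hg).symm.toLinearMap, LinearMap.ext fun m => ?_⟩
  have : (LinearMap.quotKerEquivOfSurjective g hg).symm (g m) = (LinearMap.ker g).mkQ m := by
    rw [LinearEquiv.symm_apply_eq]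
    rfl
  simp [this]

/-! ### Torsion classes under a surjective ring morphism -/

namespace TorsionClass

variable {A B : Type u} [Ring A] [Ring B]

theorem mem_of_equiv (T : TorsionClass A) {M N : ModuleCat.{u} A} (e : M ≃ₗ[A] N)
    (h : M ∈ T.carrier) : N ∈ T.carrier :=
  T.factor_mem M N e.toLinearMap e.surjective h

theorem mem_iff_of_equiv (T : TorsionClass A) {M N : ModuleCat.{u} A} (e : M ≃ₗ[A] N) :
    M ∈ T.carrier ↔ N ∈ T.carrier :=
  ⟨T.mem_of_equiv e, T.mem_of_equiv e.symm⟩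

/-- If `c` is central and acts nilpotently on `M`, then `M` lies in a torsion class as soon as its
factor modules that are annihilated by `c` do. -/
theorem mem_of_forall_factor (T : TorsionClass A) (c : A) (hc : ∀ a, c * a = a * c) (r : ℕ) :
    ∀ (M : ModuleCat.{u} A), (∀ m : M, c ^ r • m = 0) →
      (∀ (Q : ModuleCat.{u} A) (q : M →ₗ[A] Q), Function.Surjective q → (∀ x : Q, c • x = 0) →
        Q ∈ T.carrier) → M ∈ T.carrier := by
  induction r with
  | zero =>
    intro M hM _
    refine T.zero_mem M ⟨fun x y => ?_⟩
    have hx := hM x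
    have hy := hM y
    rw [pow_zero, one_smul] at hx hy
    rw [hx, hy]
  | succ r ih =>
    intro M hM hQ
    -- Multiplication by `c` is linear because `c` is central. Its image `cM` is a factor of `M`
    -- killed by `c ^ r`, and `M / cM` is killed by `c`; `M` is an extension of the two.
    let l : M →ₗ[A] M :=
      { toFun := fun m => c • m
        map_add' := smul_add c
        map_smul' := fun a m => by simp only [RingHom.id_apply, ← mul_smul, hc] }
    let K := LinearMap.range l
    have hK : ModuleCat.of A K ∈ T.carrier := by
      refine ih (ModuleCat.of A K) ?_ fun Q q hq hcQ =>
        hQ Q (q ∘ₗ l.rangeRestrict) (hq.comp l.surjective_rangeRestrict) hcQ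
      rintro ⟨_, m, rfl⟩
      refine Subtype.ext ?_
      change c ^ r • c • m = 0
      rw [← mul_smul, ← pow_succ, hM]
    have hN : ModuleCat.of A (M ⧸ K) ∈ T.carrier := by
      refine hQ (ModuleCat.of A (M ⧸ K)) K.mkQ K.mkQ_surjective fun x => ?_
      obtain ⟨m, rfl⟩ := K.mkQ_surjective x
      change c • K.mkQ m = 0
      rw [← map_smul]
      exact (Submodule.Quotient.mk_eq_zero K).2 ⟨m, rfl⟩
    exact T.ext_mem (ModuleCat.of A K) M (ModuleCat.of A (M ⧸ K)) K.subtype K.mkQ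
      K.injective_subtype (LinearMap.exact_subtype_mkQ K) K.mkQ_surjective hK hN

/-- For a surjective ring morphism `φ : A → B`, the class of the finitely generated `A`-modules
all of whose factor modules over `B` lie in `T`. -/
def induce (φ : A →+* B) (hφ : Function.Surjective φ) (T : TorsionClass B) : TorsionClass A where
  carrier := {M | Module.Finite A M ∧ ∀ (N : ModuleCat.{u} B)
    (q : M →ₗ[A] (ModuleCat.restrictScalars φ).obj N), Function.Surjective q → N ∈ T.carrier}
  finite := fun _ h => h.1
  zero_mem := fun M hM => ⟨inferInstance, fun N q hq => T.zero_mem N hq.subsingleton⟩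
  factor_mem := fun M N f hf h =>
    ⟨haveI := h.1; Module.Finite.of_surjective f hf,
      fun Q q hq => h.2 Q (q ∘ₗ f) (hq.comp hf)⟩
  ext_mem := fun K M N f g hf hfg hg hK hN => by
    refine ⟨haveI := hK.1; haveI := hN.1; Module.Finite.of_exact hfg hg, fun Q q hq => ?_⟩
    -- The image of `K` in `Q` is stable under `B` because `φ` is onto. It is a factor of `K`, and
    -- `Q / R` is a factor of `N`.
    let R : Submodule B Q :=
      { carrier := Set.range (q ∘ₗ f)
        zero_mem' := ⟨0, map_zero _⟩
        add_mem' := by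
          rintro _ _ ⟨x, rfl⟩ ⟨y, rfl⟩
          exact ⟨x + y, map_add _ x y⟩
        smul_mem' := by
          rintro b _ ⟨x, rfl⟩
          obtain ⟨a, rfl⟩ := hφ b
          exact ⟨a • x, map_smul (q ∘ₗ f) a x⟩ }
    let f' : K →ₗ[A] (ModuleCat.restrictScalars φ).obj (ModuleCat.of B R) :=
      { toFun := fun x => (⟨(q ∘ₗ f) x, x, rfl⟩ : R)
        map_add' := fun x y => Subtype.ext (map_add (q ∘ₗ f) x y)
        map_smul' := fun a x => Subtype.ext (map_smul (q ∘ₗ f) a x) }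
    have h1 : ModuleCat.of B R ∈ T.carrier := by
      refine hK.2 (ModuleCat.of B R) f' ?_
      rintro ⟨_, x, rfl⟩
      exact ⟨x, rfl⟩
    let q' : M →ₗ[A] (ModuleCat.restrictScalars φ).obj (ModuleCat.of B (Q ⧸ R)) :=
      { toFun := fun x => R.mkQ (q x)
        map_add' := fun x y => by
          rw [map_add]
          exact map_add R.mkQ (q x) (q y)
        map_smul' := fun a x => by
          rw [map_smul]
          exact map_smul R.mkQ (φ a) (q x : Q) }
    obtain ⟨s, hs⟩ := exists_comp_eq_of_exact hfg hg q' (LinearMap.ext fun x =>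
      (Submodule.Quotient.mk_eq_zero R).2 ⟨x, rfl⟩)
    have hs' : Function.Surjective s := by
      refine Function.Surjective.of_comp (g := g) ?_
      rw [← LinearMap.coe_comp, hs]
      exact R.mkQ_surjective.comp hq
    have h2 : ModuleCat.of B (Q ⧸ R) ∈ T.carrier := hN.2 _ s hs'
    exact T.ext_mem (ModuleCat.of B R) Q (ModuleCat.of B (Q ⧸ R)) R.subtype R.mkQ
      R.injective_subtype (LinearMap.exact_subtype_mkQ R) R.mkQ_surjective h1 h2

/-- Gives surjectivity of `restrict`. Since `φ` is onto, an `A`-linear surjection between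
`B`-modules is `B`-linear, so closure of `T` under factors applies. -/
theorem restrict_induce (φ : A →+* B) (hφ : Function.Surjective φ) (T : TorsionClass B) :
    (T.induce φ hφ).restrict φ = T := by
  refine TorsionClass.ext (Set.ext fun N => ⟨fun h => ?_, fun h => ?_⟩)
  · exact h.2.2 N LinearMap.id Function.surjective_id
  · have hf := T.finite N h
    refine ⟨hf, (finite_restrictScalars_iff φ hφ N).2 hf, fun N' q hq => ?_⟩
    let q' : N →ₗ[B] N' :=
      { toFun := fun x => q x
        map_add' := fun x y => map_add q x y
        map_smul' := fun b x => by
          obtain ⟨a, rfl⟩ := hφ b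
          exact q.map_smul a x }
    exact T.factor_mem N N' q' hq h

theorem restrict_mono (φ : A →+* B) {T U : TorsionClass A} (h : T ≤ U) :
    T.restrict φ ≤ U.restrict φ :=
  fun _ hN => ⟨hN.1, h hN.2⟩

/-- If the kernel of the surjection `φ` consists of multiples of a central nilpotent element, then
torsion classes are compared by their modules over the target of `φ`. -/
theorem le_of_restrict_le (φ : A →+* B) (hφ : Function.Surjective φ) (c : A)
    (hc : ∀ a, c * a = a * c) (hn : IsNilpotent c) (hker : ∀ a, φ a = 0 → ∃ b, a = c * b)
    {T U : TorsionClass A} (h : T.restrict φ ≤ U.restrict φ) : T ≤ U := by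
  intro M hM
  obtain ⟨r, hr⟩ := hn
  refine U.mem_of_forall_factor c hc r M (fun m => by rw [hr, zero_smul]) fun Q q hq hQ => ?_
  have hQT := T.factor_mem M Q q hq hM
  obtain ⟨N, ⟨e⟩⟩ := exists_restrictScalars_equiv φ hφ Q fun a ha m => by
    obtain ⟨b, rfl⟩ := hker a ha
    rw [mul_smul, hQ]
  have hN := (T.mem_iff_of_equiv e).2 hQT
  have : N ∈ (T.restrict φ).carrier := ⟨(finite_restrictScalars_iff φ hφ N).1 (T.finite _ hN), hN⟩
  exact U.mem_of_equiv e (h this).2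

/-- Restriction to the quotient by a nilpotent ideal generated by a central element, as an
isomorphism between lattices of torsion classes. -/
noncomputable def restrictOrderIso (φ : A →+* B) (hφ : Function.Surjective φ) (c : A)
    (hc : ∀ a, c * a = a * c) (hn : IsNilpotent c) (hker : ∀ a, φ a = 0 → ∃ b, a = c * b) :
    TorsionClass A ≃o TorsionClass B :=
  RelIso.ofSurjective
    (OrderEmbedding.ofMapLEIff (restrict φ) fun _ _ =>
      ⟨le_of_restrict_le φ hφ c hc hn hker, restrict_mono φ⟩)
    fun T => ⟨T.induce φ hφ, restrict_induce φ hφ T⟩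

/-! ### Two torsion classes that detect a brick -/

/-- The finitely generated modules that have no nonzero morphism to `S`. -/
def leftPerp (S : ModuleCat.{u} A) : TorsionClass A where
  carrier := {M | Module.Finite A M ∧ ∀ f : M →ₗ[A] S, f = 0}
  finite := fun _ h => h.1
  zero_mem := fun M hM => ⟨inferInstance, fun f => LinearMap.ext fun x => by
    rw [Subsingleton.elim x 0, map_zero, map_zero]⟩
  factor_mem := fun M N f hf h =>
    ⟨haveI := h.1; Module.Finite.of_surjective f hf, fun g => LinearMap.ext fun x => by
      obtain ⟨y, rfl⟩ := hf x
      exact LinearMap.congr_fun (h.2 (g ∘ₗ f)) y⟩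
  ext_mem := fun K M N f g hf hfg hg hK hN =>
    ⟨haveI := hK.1; haveI := hN.1; Module.Finite.of_exact hfg hg, fun t => by
      obtain ⟨s, rfl⟩ := exists_comp_eq_of_exact hfg hg t (hK.2 (t ∘ₗ f))
      rw [hN.2 s, LinearMap.zero_comp]⟩

/-- The finitely generated modules whose nonzero morphisms to `S` are surjective. -/
def surjectiveOrZero (S : ModuleCat.{u} A) : TorsionClass A where
  carrier := {M | Module.Finite A M ∧ ∀ f : M →ₗ[A] S, f ≠ 0 → Function.Surjective f}
  finite := fun _ h => h.1
  zero_mem := fun M hM => ⟨inferInstance, fun f hf => absurd (LinearMap.ext fun x => by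
    rw [Subsingleton.elim x 0, map_zero, map_zero]) hf⟩
  factor_mem := fun M N f hf h =>
    ⟨haveI := h.1; Module.Finite.of_surjective f hf, fun g hg =>
      Function.Surjective.of_comp (g := f) (h.2 (g ∘ₗ f) fun h0 => hg (LinearMap.ext fun x => by
        obtain ⟨y, rfl⟩ := hf x
        exact LinearMap.congr_fun h0 y))⟩
  ext_mem := fun K M N f g hf hfg hg hK hN =>
    ⟨haveI := hK.1; haveI := hN.1; Module.Finite.of_exact hfg hg, fun t ht => by
      by_cases h : t ∘ₗ f = 0
      · obtain ⟨s, rfl⟩ := exists_comp_eq_of_exact hfg hg t h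
        refine (hN.2 s fun hs => ht ?_).comp hg
        rw [hs, LinearMap.zero_comp]
      · exact Function.Surjective.of_comp (g := f) (hK.2 _ h)⟩

end TorsionClass

/-! ### Comparison of algebraic congruences -/

section Eta

variable {A B : Type u} [Ring A] [Ring B]

theorem AnnihilatedBy.of_surjective {I : TwoSidedIdeal A} {M N : ModuleCat.{u} A}
    (h : AnnihilatedBy I M) (f : M →ₗ[A] N) (hf : Function.Surjective f) : AnnihilatedBy I N := by
  intro a ha n
  obtain ⟨m, rfl⟩ := hf n
  rw [← map_smul, h a ha, map_zero]

theorem eta_le_eta_iff {I J : TwoSidedIdeal A} :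
    eta I ≤ eta J ↔ ∀ T U : TorsionClass A, (eta I).r T U → (eta J).r T U :=
  ⟨fun h _ _ hTU => h hTU, fun h T U hTU => h T U hTU⟩

theorem eta_mono {I J : TwoSidedIdeal A} (h : I ≤ J) : eta I ≤ eta J :=
  eta_le_eta_iff.2 fun _ _ hTU M hM => hTU M fun a ha => hM a (h ha)

/-- If `eta I` refines `eta J`, then the bricks annihilated by `J` are annihilated by `I`. -/
theorem IsBrick.annihilatedBy_of_eta_le {I J : TwoSidedIdeal A} (h : eta I ≤ eta J)
    {S : ModuleCat.{u} A} (hS : IsBrick A S) (hJ : AnnihilatedBy J S) : AnnihilatedBy I S := by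
  by_contra hI
  -- A nonzero map to `S` from a module killed by `I` would be surjective, and `S` would then be
  -- killed by `I`. So the two classes agree on modules over `A / I`.
  have hrel : (eta I).r (TorsionClass.surjectiveOrZero S) (TorsionClass.leftPerp S) := by
    intro M hM
    refine ⟨fun h => ⟨h.1, fun f => ?_⟩, fun h => ⟨h.1, fun f hf => absurd (h.2 f) hf⟩⟩
    by_contra hf
    exact hI (hM.of_surjective f (h.2 f hf))
  -- `S` itself separates the classes: its nonzero endomorphisms are invertible, and its identity is
  -- one of them.
  have hmem : S ∈ (TorsionClass.surjectiveOrZero S).carrier :=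
    ⟨hS.1, fun f hf => ((Module.End.isUnit_iff f).1 (hS.2.2 f hf)).surjective⟩
  have hzero := ((eta_le_eta_iff.1 h _ _ hrel S hJ).1 hmem).2 LinearMap.id
  have := hS.2.1
  exact one_ne_zero (α := Module.End A S) hzero

/-- Congruences of a quotient ring, seen on the ring itself. -/
theorem eta_rel_iff_of_surjective (φ : A →+* B) (hφ : Function.Surjective φ) {I : TwoSidedIdeal B}
    {K : TwoSidedIdeal A} (hK : ∀ a, a ∈ K ↔ φ a ∈ I) (T U : TorsionClass A) :
    (eta K).r T U ↔ (eta I).r (T.restrict φ) (U.restrict φ) := by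
  constructor
  · intro h N hN
    exact and_congr_right fun _ => h ((ModuleCat.restrictScalars φ).obj N) fun a ha m =>
      hN (φ a) ((hK _).1 ha) m
  · intro h M hM
    obtain ⟨N, ⟨e⟩⟩ := exists_restrictScalars_equiv φ hφ M fun a ha m =>
      hM a ((hK _).2 (ha ▸ I.zero_mem)) m
    have hN : AnnihilatedBy I N := by
      intro b hb x
      obtain ⟨a, rfl⟩ := hφ b
      exact hM.of_surjective e.symm.toLinearMap e.symm.surjective a
        ((hK _).2 hb) x
    have hfin (T : TorsionClass A) : N ∈ (T.restrict φ).carrier ↔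
        (ModuleCat.restrictScalars φ).obj N ∈ T.carrier :=
      ⟨fun h => h.2, fun h => ⟨(finite_restrictScalars_iff φ hφ N).1 (T.finite _ h), h⟩⟩
    rw [← T.mem_iff_of_equiv e, ← U.mem_iff_of_equiv e, ← hfin, ← hfin]
    exact h N hN

/-- Adding a nilpotent ideal generated by a central element does not change the congruence. -/
theorem eta_sup_eq {c : A} (hc : ∀ a, c * a = a * c) (hn : IsNilpotent c) (I J : TwoSidedIdeal A)
    (hJ : ∀ a ∈ J, ∃ b, a = c * b) : eta (I ⊔ J) = eta I := by
  refine le_antisymm (eta_le_eta_iff.2 fun T U h M hM => ?_) (eta_mono le_sup_left)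
  obtain ⟨r, hr⟩ := hn
  have key : ∀ T U : TorsionClass A, (eta (I ⊔ J)).r T U → M ∈ T.carrier → M ∈ U.carrier := by
    intro T U h hT
    -- Only factors of `M` killed by `c` matter. These are killed by `J`, whose elements are
    -- multiples of `c`, and by `I`, because `M` is.
    refine U.mem_of_forall_factor c hc r M (fun m => by rw [hr, zero_smul]) fun Q q hq hQ => ?_
    refine (h Q fun a ha x => ?_).1 (T.factor_mem M Q q hq hT)
    obtain ⟨y, hy, z, hz, rfl⟩ := TwoSidedIdeal.mem_sup.1 ha
    obtain ⟨b, rfl⟩ := hJ z hz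
    rw [add_smul, hM.of_surjective q hq y hy, mul_smul, hQ, add_zero]
  exact ⟨key T U h, key U T ((eta (I ⊔ J)).iseqv.symm h)⟩

theorem mem_map_iff_of_surjective (φ : A →+* B) (hφ : Function.Surjective φ) (I : TwoSidedIdeal A)
    (b : B) : b ∈ I.map φ ↔ ∃ a ∈ I, φ a = b := by
  let J : TwoSidedIdeal B := TwoSidedIdeal.mk' (φ '' I) ⟨0, I.zero_mem, map_zero φ⟩
    (by rintro _ _ ⟨x, hx, rfl⟩ ⟨y, hy, rfl⟩; exact ⟨x + y, I.add_mem hx hy, map_add φ x y⟩)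
    (by rintro _ ⟨x, hx, rfl⟩; exact ⟨-x, I.neg_mem hx, map_neg φ x⟩)
    (by
      rintro b _ ⟨y, hy, rfl⟩
      obtain ⟨x, rfl⟩ := hφ b
      exact ⟨x * y, I.mul_mem_left x y hy, map_mul φ x y⟩)
    (by
      rintro _ b ⟨x, hx, rfl⟩
      obtain ⟨y, rfl⟩ := hφ b
      exact ⟨x * y, I.mul_mem_right x y hx, map_mul φ x y⟩)
  have hJ : I.map φ ≤ J := TwoSidedIdeal.span_le.2 fun b hb => (TwoSidedIdeal.mem_mk' ..).2 hb
  refine ⟨fun hb => (TwoSidedIdeal.mem_mk' (φ '' I) ..).1 (hJ hb), ?_⟩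
  rintro ⟨a, ha, rfl⟩
  exact TwoSidedIdeal.subset_span ⟨a, ha, rfl⟩

end Eta

/-! ### Paths in the double quiver of type `A` -/

namespace TypeA

open Quiver

variable {n : ℕ}

instance instDecidableEqSymmetrify : DecidableEq (Symmetrify (TypeA n)) :=
  inferInstanceAs (DecidableEq (Fin n))

/-- The number of a vertex of the double quiver. -/
def height (i : Symmetrify (TypeA n)) : ℕ := TypeA.val (n := n) i

theorem height_injective : Function.Injective (height (n := n)) := fun _ _ h => Fin.ext h

theorem height_lt (i : Symmetrify (TypeA n)) : height i < n := Fin.isLt (n := n) i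

theorem exists_height_eq {m : ℕ} (h : m < n) : ∃ i : Symmetrify (TypeA n), height i = m :=
  ⟨(⟨m, h⟩ : Fin n), rfl⟩

/-- The distance between two vertices of the double quiver. -/
def vdist (i j : Symmetrify (TypeA n)) : ℕ := Nat.dist (height i) (height j)

/-- Truncated subtractions put statements about positions of vertices within reach of `omega`. -/
theorem vdist_def (i j : Symmetrify (TypeA n)) :
    vdist i j = height i - height j + (height j - height i) := rfl

theorem height_arrow {i j : Symmetrify (TypeA n)} (a : i ⟶ j) :
    height i + 1 = height j ∨ height j + 1 = height i := by
  rcases a with ⟨⟨h⟩⟩ | ⟨⟨h⟩⟩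
  exacts [Or.inl h, Or.inr h]

theorem nonempty_arrow {i j : Symmetrify (TypeA n)}
    (h : height i + 1 = height j ∨ height j + 1 = height i) : Nonempty (i ⟶ j) := by
  rcases h with h | h
  exacts [⟨Sum.inl ⟨h⟩⟩, ⟨Sum.inr ⟨h⟩⟩]

instance instSubsingletonArrow (i j : Symmetrify (TypeA n)) : Subsingleton (i ⟶ j) := by
  constructor
  rintro (⟨⟨h⟩⟩ | ⟨⟨h⟩⟩) (⟨⟨h'⟩⟩ | ⟨⟨h'⟩⟩)
  · rfl
  · exact absurd h (by omega)
  · exact absurd h (by omega)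
  · rfl

theorem vdist_le_length {i j : Symmetrify (TypeA n)} (p : Path i j) : vdist i j ≤ p.length := by
  induction p with
  | nil => simp [vdist_def]
  | cons p a ih =>
    have := height_arrow a
    simp only [vdist_def, Path.length_cons] at *
    omega

/-- A shortest path moves in one direction only, so it sweeps out exactly the interval between its
ends. -/
theorem mem_vertices_iff {i j : Symmetrify (TypeA n)} (p : Path i j) (h : p.length = vdist i j)
    (v : Symmetrify (TypeA n)) : v ∈ p.vertices ↔ vdist i v + vdist v j = vdist i j := by
  induction p with
  | nil =>
    rw [Path.vertices_nil, List.mem_singleton, ← height_injective.eq_iff]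
    simp only [vdist_def]
    omega
  | cons p a ih =>
    have ha := height_arrow a
    have hp := vdist_le_length p
    rw [Path.length_cons] at h
    rw [Path.vertices_cons, List.concat_eq_append, List.mem_append, List.mem_singleton,
      ih (by simp only [vdist_def] at *; omega), ← height_injective.eq_iff]
    simp only [vdist_def] at *
    omega

/-- By induction the initial part is shortest and fills an interval; one more arrow reaches a new
vertex exactly when it leads away from the start. -/
theorem nodup_vertices_iff {i j : Symmetrify (TypeA n)} (p : Path i j) :
    p.vertices.Nodup ↔ p.length = vdist i j := by
  induction p with
  | nil => simp [vdist_def]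
  | cons p a ih =>
    have ha := height_arrow a
    have hp := vdist_le_length p
    rw [Path.vertices_cons, List.nodup_concat, ih, Path.length_cons]
    constructor
    · rintro ⟨h, h'⟩
      rw [mem_vertices_iff p h'] at h
      simp only [vdist_def] at *
      omega
    · intro h
      have h' := le_antisymm (show p.length ≤ _ by simp only [vdist_def] at *; omega) hp
      rw [mem_vertices_iff p h']
      simp only [vdist_def] at *
      omega

/-- The last vertex but one must be the neighbour of the end on the side of `i`, and there is at
most one arrow between two vertices. -/
theorem path_eq_of_length_eq {i j : Symmetrify (TypeA n)} (p q : Path i j)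
    (hp : p.length = vdist i j) (hq : q.length = vdist i j) : p = q := by
  induction p with
  | nil =>
    refine (Path.eq_nil_of_length_zero q ?_).symm
    rw [hq, vdist_def]
    omega
  | @cons b c p a ih =>
    cases q with
    | nil =>
      rw [Path.length_nil] at hq
      rw [← hq, Path.length_cons] at hp
      omega
    | @cons b' _ q a' =>
      have ha := height_arrow a
      have ha' := height_arrow a'
      have hp' := vdist_le_length p
      have hq' := vdist_le_length q
      rw [Path.length_cons] at hp hq
      obtain rfl : b = b' := height_injective (by simp only [vdist_def] at *; omega)
      obtain rfl := Subsingleton.elim a a'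
      rw [ih q (by simp only [vdist_def] at *; omega) (by simp only [vdist_def] at *; omega)]

theorem exists_path_length_eq (i j : Symmetrify (TypeA n)) :
    ∃ p : Path i j, p.length = vdist i j := by
  generalize hd : vdist i j = d
  induction d generalizing j with
  | zero =>
    obtain rfl : i = j := height_injective (by rw [vdist_def] at hd; omega)
    exact ⟨Path.nil, rfl⟩
  | succ d ih =>
    have hi := height_lt i
    have hj := height_lt j
    obtain ⟨j', hj', hd'⟩ : ∃ j' : Symmetrify (TypeA n),
        (height j' + 1 = height j ∨ height j + 1 = height j') ∧ vdist i j' = d := by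
      rw [vdist_def] at hd
      rcases lt_or_ge (height i) (height j) with h | h
      · obtain ⟨j', hj'⟩ := exists_height_eq (n := n) (m := height j - 1) (by omega)
        exact ⟨j', by omega, by rw [vdist_def]; omega⟩
      · obtain ⟨j', hj'⟩ := exists_height_eq (n := n) (m := height j + 1) (by omega)
        exact ⟨j', by omega, by rw [vdist_def]; omega⟩
    obtain ⟨p, hp⟩ := ih j' hd'
    obtain ⟨a⟩ := nonempty_arrow hj'
    exact ⟨p.cons a, by rw [Path.length_cons, hp]⟩

/-- The shortest path between two vertices. -/
noncomputable def geodesic (i j : Symmetrify (TypeA n)) : Path i j :=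
  (exists_path_length_eq i j).choose

theorem length_geodesic (i j : Symmetrify (TypeA n)) : (geodesic i j).length = vdist i j :=
  (exists_path_length_eq i j).choose_spec

theorem eq_geodesic {i j : Symmetrify (TypeA n)} (p : Path i j) (hp : p.length = vdist i j) :
    p = geodesic i j :=
  path_eq_of_length_eq p _ hp (length_geodesic i j)

theorem geodesic_self (i : Symmetrify (TypeA n)) : geodesic i i = Path.nil :=
  (eq_geodesic Path.nil (by simp [vdist_def])).symm

/-- The shortest path between two vertices, as a non-revisiting path. -/
noncomputable def geodesicPath (i j : Symmetrify (TypeA n)) : PathsA n :=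
  ⟨i, j, geodesic i j, (nodup_vertices_iff _).2 (length_geodesic i j)⟩

theorem eq_geodesicPath (p : PathsA n) : p = geodesicPath p.source p.target := by
  obtain ⟨i, j, p, hp⟩ := p
  obtain rfl := eq_geodesic p ((nodup_vertices_iff p).1 hp)
  rfl

/-- The shortest path from `i` to `j` passes through `a` and then through `b`. -/
def Passes (i j a b : Symmetrify (TypeA n)) : Prop :=
  vdist i a + vdist a b + vdist b j = vdist i j

instance instDecidablePasses (i j a b : Symmetrify (TypeA n)) : Decidable (Passes i j a b) :=
  inferInstanceAs (Decidable (_ = _))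

/-- Distances are bounded by lengths, so a factorization of a shortest path forces equality in the
triangle inequality. Conversely, shortest paths whose lengths add up correctly compose to the
shortest path, by uniqueness. -/
theorem geodesicPath_le_iff {i j a b : Symmetrify (TypeA n)} :
    geodesicPath a b ≤ geodesicPath i j ↔ Passes i j a b := by
  constructor
  · rintro ⟨q, r, h⟩
    have key (q : Path i a) (r : Path b j)
        (h : geodesic i j = Path.comp q (Path.comp (geodesic a b) r)) : Passes i j a b := by
      have hlen := congrArg Path.length h
      rw [Path.length_comp, Path.length_comp, length_geodesic, length_geodesic] at hlen
      have hq := vdist_le_length q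
      have hr := vdist_le_length r
      simp only [Passes, vdist_def] at *
      omega
    exact key q r h
  · intro h
    refine ⟨geodesic i a, geodesic b j, (eq_geodesic _ ?_).symm⟩
    change (Path.comp (geodesic i a) (Path.comp (geodesic a b) (geodesic b j))).length = vdist i j
    rw [Path.length_comp, Path.length_comp, length_geodesic, length_geodesic, length_geodesic,
      ← add_assoc]
    exact h

end TypeA

/-! ### Central elements and ideals -/

/-- The multiples of a central element already form a two-sided ideal. -/
theorem exists_eq_mul_of_mem_span {R : Type*} [Ring R] {c : R} (hc : ∀ a, c * a = a * c) {S : Set R}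
    (hS : ∀ s ∈ S, ∃ y, s = c * y) {x : R} (hx : x ∈ TwoSidedIdeal.span S) : ∃ y, x = c * y := by
  let J : TwoSidedIdeal R := TwoSidedIdeal.mk' {x | ∃ y, x = c * y} ⟨0, (mul_zero _).symm⟩
    (by rintro _ _ ⟨x, rfl⟩ ⟨y, rfl⟩; exact ⟨x + y, (mul_add _ _ _).symm⟩)
    (by rintro _ ⟨x, rfl⟩; exact ⟨-x, (mul_neg _ _).symm⟩)
    (by rintro z _ ⟨x, rfl⟩; exact ⟨z * x, by rw [← mul_assoc, ← hc, mul_assoc]⟩)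
    (by rintro _ z ⟨x, rfl⟩; exact ⟨x * z, mul_assoc _ _ _⟩)
  have hJ : TwoSidedIdeal.span S ≤ J :=
    TwoSidedIdeal.span_le.2 fun s hs => (TwoSidedIdeal.mem_mk' ..).2 (hS s hs)
  have hx' : x ∈ J := hJ hx
  rwa [TwoSidedIdeal.mem_mk'] at hx'

/-- If `p = e p f` lies in an ideal up to a multiple `c x` of a central nilpotent element, and
`e x f` is a multiple of `p`, then `p` lies in the ideal. -/
theorem mem_of_add_central_mul_eq {R : Type*} [Ring R] (I : TwoSidedIdeal R) {c p x y e f d : R}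
    (hc : ∀ a, c * a = a * c) (hn : IsNilpotent c) (hy : y ∈ I) (h : y + c * x = p)
    (he : e * p = p) (hf : p * f = p) (hx : e * x * f = p * d) : p ∈ I := by
  -- Compress `y = p - c x` by `e` and `f`: the right side becomes `p - c p d`. The factor `1 - c d`
  -- is a unit because `c d` is nilpotent.
  have hmem : p * (1 - c * d) = e * y * f := by
    have hcx : e * (c * x) * f = c * (e * x * f) := by
      rw [← mul_assoc e, ← hc, mul_assoc, mul_assoc, mul_assoc]
    rw [eq_sub_of_add_eq h, mul_sub e, sub_mul, he, hf, hcx, hx, mul_sub, mul_one,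
      ← mul_assoc, ← mul_assoc, ← hc]
  have hcd : Commute c d := hc d
  obtain ⟨u, hu⟩ := (hcd.isNilpotent_mul_right hn).isUnit_one_sub
  have hw : p = e * y * f * ↑u⁻¹ := by
    rw [← hmem, ← hu, mul_assoc, Units.mul_inv, mul_one]
  rw [hw]
  exact I.mul_mem_right _ _ (I.mul_mem_right _ _ (I.mul_mem_left _ _ hy))

/-! ### The preprojective algebra of type `A` -/

namespace PiA

open Quiver TypeA

variable (k : Type u) [Field k] {n : ℕ}

/-- The idempotent of a vertex. -/
noncomputable def vertex (i : Symmetrify (TypeA n)) : PiA k n :=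
  RingQuot.mkAlgHom k (PreprojRel k (TypeA n)) (PathAlgebra.vertex k i)

/-- The element of `Π` given by an arbitrary path. -/
noncomputable def word {i j : Symmetrify (TypeA n)} (p : Path i j) : PiA k n :=
  RingQuot.mkAlgHom k (PreprojRel k (TypeA n)) (PathAlgebra.ofPath k p)

theorem vertex_mul_self (i : Symmetrify (TypeA n)) : vertex k i * vertex k i = vertex k i := by
  simp only [vertex, PathAlgebra.vertex, ← map_mul]
  rw [RingQuot.mkAlgHom_rel k (PathAlgebra.Rel.idem i)]

theorem vertex_mul_vertex {i j : Symmetrify (TypeA n)} (h : i ≠ j) :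
    vertex k i * vertex k j = 0 := by
  simp only [vertex, PathAlgebra.vertex, ← map_mul]
  rw [RingQuot.mkAlgHom_rel k (PathAlgebra.Rel.orth i j h), map_zero, map_zero]

variable (n) in
theorem sum_vertex : ∑ i : Symmetrify (TypeA n), vertex k i = 1 := by
  simp only [vertex, PathAlgebra.vertex, ← map_sum]
  rw [RingQuot.mkAlgHom_rel k PathAlgebra.Rel.sum_eq_one, map_one, map_one]

theorem vertex_mul_arrow {i j : Symmetrify (TypeA n)} (a : i ⟶ j) :
    vertex k i * arrow k n a = arrow k n a := by
  simp only [vertex, arrow, PathAlgebra.vertex, PathAlgebra.arrow, ← map_mul]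
  rw [RingQuot.mkAlgHom_rel k (PathAlgebra.Rel.source a)]

theorem arrow_mul_vertex {i j : Symmetrify (TypeA n)} (a : i ⟶ j) :
    arrow k n a * vertex k j = arrow k n a := by
  simp only [vertex, arrow, PathAlgebra.vertex, PathAlgebra.arrow, ← map_mul]
  rw [RingQuot.mkAlgHom_rel k (PathAlgebra.Rel.target a)]

theorem vertex_mul_arrow_of_ne {x i j : Symmetrify (TypeA n)} (a : i ⟶ j) (h : x ≠ i) :
    vertex k x * arrow k n a = 0 := by
  rw [← vertex_mul_arrow, ← mul_assoc, vertex_mul_vertex k h, zero_mul]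

theorem arrow_mul_vertex_of_ne {x i j : Symmetrify (TypeA n)} (a : i ⟶ j) (h : j ≠ x) :
    arrow k n a * vertex k x = 0 := by
  rw [← arrow_mul_vertex, mul_assoc, vertex_mul_vertex k h, mul_zero]

theorem word_nil (i : Symmetrify (TypeA n)) : word k (Path.nil : Path i i) = vertex k i := rfl

theorem word_cons {i j l : Symmetrify (TypeA n)} (p : Path i j) (a : j ⟶ l) :
    word k (p.cons a) = word k p * arrow k n a :=
  map_mul _ _ _

theorem word_mul_vertex {i j : Symmetrify (TypeA n)} (p : Path i j) :
    word k p * vertex k j = word k p := by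
  cases p with
  | nil => rw [word_nil, vertex_mul_self]
  | cons p a => rw [word_cons, mul_assoc, arrow_mul_vertex]

theorem vertex_mul_word {i j : Symmetrify (TypeA n)} (p : Path i j) :
    vertex k i * word k p = word k p := by
  induction p with
  | nil => rw [word_nil, vertex_mul_self]
  | cons p a ih => rw [word_cons, ← mul_assoc, ih]

theorem word_mul_vertex_of_ne {x i j : Symmetrify (TypeA n)} (p : Path i j) (h : j ≠ x) :
    word k p * vertex k x = 0 := by
  rw [← word_mul_vertex, mul_assoc, vertex_mul_vertex k h, mul_zero]

theorem vertex_mul_word_of_ne {x i j : Symmetrify (TypeA n)} (p : Path i j) (h : x ≠ i) :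
    vertex k x * word k p = 0 := by
  rw [← vertex_mul_word, ← mul_assoc, vertex_mul_vertex k h, zero_mul]

theorem word_comp {i j l : Symmetrify (TypeA n)} (p : Path i j) (q : Path j l) :
    word k (p.comp q) = word k p * word k q := by
  induction q with
  | nil => rw [Path.comp_nil, word_nil, word_mul_vertex]
  | cons q a ih => rw [Path.comp_cons, word_cons, word_cons, ih, mul_assoc]

theorem ofPath_eq (p : PathsA n) : ofPath k n p = word k (geodesic p.source p.target) := by
  rw [← eq_geodesic p.path ((nodup_vertices_iff _).1 p.nodup)]
  rfl

variable {k} in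
/-- Induction on the elements of `Π`, from the vertices and the arrows. -/
theorem induction_on {P : PiA k n → Prop} (x : PiA k n) (scalar : ∀ r, P (algebraMap k _ r))
    (add : ∀ x y, P x → P y → P (x + y)) (mul : ∀ x y, P x → P y → P (x * y))
    (vertex : ∀ i, P (vertex k i))
    (arrow : ∀ (i j : Symmetrify (TypeA n)) (a : i ⟶ j), P (arrow k n a)) : P x := by
  obtain ⟨y, rfl⟩ := RingQuot.mkAlgHom_surjective k _ x
  obtain ⟨z, rfl⟩ := RingQuot.mkAlgHom_surjective k _ y
  induction z using FreeAlgebra.induction with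
  | grade0 r => simpa only [AlgHom.commutes] using scalar r
  | grade1 g =>
    cases g with
    | vertex i => exact vertex i
    | arrow a => exact arrow _ _ a
  | mul x y hx hy => simpa only [map_mul] using mul _ _ hx hy
  | add x y hx hy => simpa only [map_add] using add _ _ hx hy

/-- The elements given by the paths span `Π`. -/
theorem mem_span_word (x : PiA k n) :
    x ∈ Submodule.span k {w | ∃ (i j : Symmetrify (TypeA n)) (p : Path i j), w = word k p} := by
  set Sp := Submodule.span k {w | ∃ (i j : Symmetrify (TypeA n)) (p : Path i j), w = word k p}
  have key (x : PiA k n) : ∀ y ∈ Sp, y * x ∈ Sp := by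
    have of_word (z : PiA k n)
        (h : ∀ (i j : Symmetrify (TypeA n)) (p : Path i j), word k p * z ∈ Sp) :
        ∀ y ∈ Sp, y * z ∈ Sp := by
      intro y hy
      induction hy using Submodule.span_induction with
      | mem w hw =>
        obtain ⟨i, j, p, rfl⟩ := hw
        exact h i j p
      | zero => rw [zero_mul]; exact Sp.zero_mem
      | add y y' _ _ hy hy' => rw [add_mul]; exact Sp.add_mem hy hy'
      | smul r y _ hy => rw [smul_mul_assoc]; exact Sp.smul_mem r hy
    induction x using induction_on with
    | scalar r =>
      intro y hy
      rw [← Algebra.commutes, ← Algebra.smul_def]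
      exact Sp.smul_mem r hy
    | add x x' hx hx' =>
      intro y hy
      rw [mul_add]
      exact Sp.add_mem (hx y hy) (hx' y hy)
    | mul x x' hx hx' =>
      intro y hy
      rw [← mul_assoc]
      exact hx' _ (hx y hy)
    | vertex l =>
      refine of_word _ fun i j p => ?_
      by_cases h : j = l
      · subst h
        rw [word_mul_vertex]
        exact Submodule.subset_span ⟨i, j, p, rfl⟩
      · rw [word_mul_vertex_of_ne k p h]
        exact Sp.zero_mem
    | arrow l m a =>
      refine of_word _ fun i j p => ?_
      by_cases h : j = l
      · subst h
        rw [← word_cons]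
        exact Submodule.subset_span ⟨i, m, p.cons a, rfl⟩
      · rw [← vertex_mul_arrow, ← mul_assoc, word_mul_vertex_of_ne k p h, zero_mul]
        exact Sp.zero_mem
  rw [← one_mul x]
  refine key x 1 ?_
  rw [← sum_vertex]
  exact Sp.sum_mem fun i _ => Submodule.subset_span ⟨i, i, Path.nil, rfl⟩

/-! ### The central element -/

variable (n) in
/-- The sum of the 2-cycles `a a*`, a central element of `Π`. -/
noncomputable def central : PiA k n :=
  ∑ i : TypeA n, ∑ j : TypeA n, ∑ a : i ⟶ j, arrow k n a.toPos * arrow k n a.toNeg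

variable (n) in
theorem central_eq : central k n =
    ∑ i : TypeA n, ∑ j : TypeA n, ∑ a : i ⟶ j, arrow k n a.toNeg * arrow k n a.toPos := by
  have h := RingQuot.mkAlgHom_rel k (PreprojRel.rel (k := k) (V := TypeA n))
  rw [map_zero] at h
  simp only [map_sum, map_sub, map_mul, Finset.sum_sub_distrib] at h
  exact sub_eq_zero.1 h

/-- A vertex has at most one outgoing and one incoming arrow in the linear quiver, so no arrow other
than `a` shares its source or its target. -/
theorem sum_arrows_eq {M : Type*} [AddCommMonoid M] (F : ∀ i j : TypeA n, (i ⟶ j) → M)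
    {x y : TypeA n} (a : x ⟶ y)
    (h : ∀ (i j : TypeA n) (b : i ⟶ j), i ≠ x → j ≠ y → F i j b = 0) :
    ∑ i : TypeA n, ∑ j : TypeA n, ∑ b : i ⟶ j, F i j b = F x y a := by
  have hinj {i j : TypeA n} (h : TypeA.val i = TypeA.val j) : i = j := Fin.ext h
  have ha : TypeA.val x + 1 = TypeA.val y := a.down
  rw [Finset.sum_eq_single x, Finset.sum_eq_single y, Finset.sum_eq_single a]
  · exact fun b _ hb => absurd (Subsingleton.elim (α := PLift _) b a) hb
  · exact fun hb => absurd (Finset.mem_univ _) hb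
  · intro j _ hj
    refine Finset.sum_eq_zero fun b _ => absurd (hinj ?_) hj
    have hb : TypeA.val x + 1 = TypeA.val j := b.down
    omega
  · exact fun hb => absurd (Finset.mem_univ _) hb
  · intro i _ hi
    refine Finset.sum_eq_zero fun j _ => Finset.sum_eq_zero fun b _ => h i j b hi fun hj => ?_
    have hb : TypeA.val i + 1 = TypeA.val j := b.down
    subst hj
    exact hi (hinj (by omega))
  · exact fun hb => absurd (Finset.mem_univ _) hb

/-- This and the next three lemmas extract the 2-cycles at a vertex from `c`, on either side since
centrality is not yet known. The defining sum yields the cycles `a a*`, the sum in `central_eq` the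
cycles `a* a`. -/
theorem vertex_mul_central_of_pos {x y : TypeA n} (a : x ⟶ y) :
    vertex k (n := n) x * central k n = arrow k n a.toPos * arrow k n a.toNeg := by
  rw [central, Finset.mul_sum]
  simp only [Finset.mul_sum]
  refine (sum_arrows_eq (fun i j (b : i ⟶ j) =>
    vertex k (n := n) x * (arrow k n b.toPos * arrow k n b.toNeg)) a fun i j b hi _ => ?_).trans ?_
  · rw [← mul_assoc, vertex_mul_arrow_of_ne k b.toPos (Ne.symm hi), zero_mul]
  · rw [← mul_assoc, vertex_mul_arrow k a.toPos]

theorem central_mul_vertex_of_pos {x y : TypeA n} (a : x ⟶ y) :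
    central k n * vertex k (n := n) x = arrow k n a.toPos * arrow k n a.toNeg := by
  rw [central, Finset.sum_mul]
  simp only [Finset.sum_mul]
  refine (sum_arrows_eq (fun i j (b : i ⟶ j) =>
    arrow k n b.toPos * arrow k n b.toNeg * vertex k (n := n) x) a fun i j b hi _ => ?_).trans ?_
  · rw [mul_assoc, arrow_mul_vertex_of_ne k b.toNeg hi, mul_zero]
  · rw [mul_assoc, arrow_mul_vertex k a.toNeg]

theorem vertex_mul_central_of_neg {x y : TypeA n} (a : x ⟶ y) :
    vertex k (n := n) y * central k n = arrow k n a.toNeg * arrow k n a.toPos := by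
  rw [central_eq, Finset.mul_sum]
  simp only [Finset.mul_sum]
  refine (sum_arrows_eq (fun i j (b : i ⟶ j) =>
    vertex k (n := n) y * (arrow k n b.toNeg * arrow k n b.toPos)) a fun i j b _ hj => ?_).trans ?_
  · rw [← mul_assoc, vertex_mul_arrow_of_ne k b.toNeg (Ne.symm hj), zero_mul]
  · rw [← mul_assoc, vertex_mul_arrow k a.toNeg]

theorem central_mul_vertex_of_neg {x y : TypeA n} (a : x ⟶ y) :
    central k n * vertex k (n := n) y = arrow k n a.toNeg * arrow k n a.toPos := by
  rw [central_eq, Finset.sum_mul]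
  simp only [Finset.sum_mul]
  refine (sum_arrows_eq (fun i j (b : i ⟶ j) =>
    arrow k n b.toNeg * arrow k n b.toPos * vertex k (n := n) y) a fun i j b _ hj => ?_).trans ?_
  · rw [mul_assoc, arrow_mul_vertex_of_ne k b.toPos hj, mul_zero]
  · rw [mul_assoc, arrow_mul_vertex k a.toPos]

theorem arrow_mul_arrow {i j : Symmetrify (TypeA n)} (a : i ⟶ j) (b : j ⟶ i) :
    arrow k n a * arrow k n b = vertex k i * central k n := by
  rcases a with a | a
  · obtain rfl : b = Sum.inr a := Subsingleton.elim _ _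
    exact (vertex_mul_central_of_pos k a).symm
  · obtain rfl : b = Sum.inl a := Subsingleton.elim _ _
    exact (vertex_mul_central_of_neg k a).symm

theorem arrow_mul_arrow' {i j : Symmetrify (TypeA n)} (a : i ⟶ j) (b : j ⟶ i) :
    arrow k n a * arrow k n b = central k n * vertex k i := by
  rcases a with a | a
  · obtain rfl : b = Sum.inr a := Subsingleton.elim _ _
    exact (central_mul_vertex_of_pos k a).symm
  · obtain rfl : b = Sum.inl a := Subsingleton.elim _ _
    exact (central_mul_vertex_of_neg k a).symm

/-- In the form `∑ a* a`, every term starts at the target of an arrow of the linear quiver, and the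
first vertex is not such a target. -/
theorem vertex_mul_central_of_height_eq_zero {i : Symmetrify (TypeA n)} (h : height i = 0) :
    vertex k i * central k n = 0 := by
  rw [central_eq, Finset.mul_sum]
  refine Finset.sum_eq_zero fun x _ => ?_
  rw [Finset.mul_sum]
  refine Finset.sum_eq_zero fun y _ => ?_
  rw [Finset.mul_sum]
  refine Finset.sum_eq_zero fun a _ => ?_
  rw [← mul_assoc, vertex_mul_arrow_of_ne k a.toNeg, zero_mul]
  rintro rfl
  have ha : TypeA.val x + 1 = height (n := n) i := a.down
  omega

/-- With `b` the reverse of `a`, both sides equal `a b a`. -/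
theorem central_mul_arrow {i j : Symmetrify (TypeA n)} (a : i ⟶ j) :
    central k n * arrow k n a = arrow k n a * central k n := by
  obtain ⟨b⟩ := nonempty_arrow (height_arrow a).symm
  rw [← vertex_mul_arrow, ← mul_assoc, ← arrow_mul_arrow' k a b, mul_assoc,
    arrow_mul_arrow k b a, ← mul_assoc, arrow_mul_vertex, vertex_mul_arrow]

theorem central_mul_vertex (i : Symmetrify (TypeA n)) :
    central k n * vertex k i = vertex k i * central k n := by
  by_cases h : ∃ j : Symmetrify (TypeA n), Nonempty (i ⟶ j)
  · obtain ⟨j, ⟨a⟩⟩ := h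
    obtain ⟨b⟩ := nonempty_arrow (height_arrow a).symm
    rw [← arrow_mul_arrow k a b, arrow_mul_arrow' k a b]
  -- If the sum defining `c` had a term, there would be at least two vertices and `i` would have a
  -- neighbour.
  · have hz : central k n = 0 := by
      refine Finset.sum_eq_zero fun x _ => Finset.sum_eq_zero fun y _ =>
        Finset.sum_eq_zero fun a _ => absurd ?_ h
      have hi := height_lt i
      have ha : TypeA.val x + 1 = height (n := n) y := a.down
      have hy := height_lt (n := n) y
      rcases Nat.eq_zero_or_pos (height i) with h0 | h0
      · obtain ⟨j, hj⟩ := exists_height_eq (n := n) (m := 1) (by omega)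
        exact ⟨j, nonempty_arrow (by omega)⟩
      · obtain ⟨j, hj⟩ := exists_height_eq (n := n) (m := height i - 1) (by omega)
        exact ⟨j, nonempty_arrow (by omega)⟩
    rw [hz, zero_mul, mul_zero]

theorem central_mul (x : PiA k n) : central k n * x = x * central k n := by
  induction x using induction_on with
  | scalar r => exact (Algebra.commutes r _).symm
  | add x y hx hy => rw [mul_add, add_mul, hx, hy]
  | mul x y hx hy => rw [← mul_assoc, hx, mul_assoc, hy, mul_assoc]
  | vertex i => exact central_mul_vertex k i
  | arrow i j a => exact central_mul_arrow k a

theorem commute_central_pow (m : ℕ) (x : PiA k n) :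
    central k n ^ m * x = x * central k n ^ m :=
  (Commute.pow_left (central_mul k x) m)

/-- Write `e_i c = a b` through the vertex `j` just below `i`. The remaining power of `c` moves next
to `e_j`, where it vanishes by induction. -/
theorem vertex_mul_central_pow (i : Symmetrify (TypeA n)) :
    vertex k i * central k n ^ (height i + 1) = 0 := by
  generalize hm : height i = m
  induction m generalizing i with
  | zero => rw [zero_add, pow_one, vertex_mul_central_of_height_eq_zero k hm]
  | succ m ih =>
    have hi := height_lt i
    obtain ⟨j, hj⟩ := exists_height_eq (n := n) (m := m) (by omega)
    obtain ⟨a⟩ := nonempty_arrow (i := i) (j := j) (by omega)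
    obtain ⟨b⟩ := nonempty_arrow (i := j) (j := i) (by omega)
    rw [pow_succ', ← mul_assoc, ← arrow_mul_arrow k a b, mul_assoc, ← commute_central_pow,
      ← arrow_mul_vertex, mul_assoc, ← mul_assoc (vertex k j), ih j hj, zero_mul, mul_zero]

variable (n) in
theorem isNilpotent_central : IsNilpotent (central k n) := by
  refine ⟨n, ?_⟩
  rw [← one_mul (central k n ^ n), ← sum_vertex, Finset.sum_mul]
  refine Finset.sum_eq_zero fun i _ => ?_
  have hi := height_lt i
  obtain ⟨m, hm⟩ := Nat.exists_eq_add_of_le (show height i + 1 ≤ n by omega)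
  have hp : central k n ^ n = central k n ^ (height i + 1) * central k n ^ m := by
    rw [← pow_add, ← hm]
  rw [hp, ← mul_assoc, vertex_mul_central_pow, zero_mul]

variable (n) in
theorem central_mem_cycIdeal : central k n ∈ cycIdeal k n :=
  sum_mem fun _ _ => sum_mem fun _ _ => sum_mem fun a _ =>
    TwoSidedIdeal.subset_span ⟨_, _, a.toPos, a.toNeg, rfl⟩

theorem mem_cycIdeal_iff (x : PiA k n) : x ∈ cycIdeal k n ↔ ∃ y, x = central k n * y := by
  constructor
  · intro hx
    refine exists_eq_mul_of_mem_span (central_mul k) ?_ hx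
    rintro _ ⟨i, j, a, b, rfl⟩
    exact ⟨vertex k i, arrow_mul_arrow' k a b⟩
  · rintro ⟨y, rfl⟩
    exact TwoSidedIdeal.mul_mem_right _ _ _ (central_mem_cycIdeal k n)

/-! ### Normal form of paths -/

/-- Every path equals, in `Π`, the shortest path with the same ends times a power of the central
element. -/
theorem exists_word_eq {i j : Symmetrify (TypeA n)} (p : Path i j) :
    ∃ m, word k p = word k (geodesic i j) * central k n ^ m ∧ p.length = vdist i j + 2 * m := by
  induction p with
  | nil => exact ⟨0, by rw [geodesic_self, pow_zero, mul_one], by simp [vdist_def]⟩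
  | @cons j l p a ih =>
    obtain ⟨m, hm, hl⟩ := ih
    have ha := height_arrow a
    rw [word_cons, hm, mul_assoc, commute_central_pow, ← mul_assoc, Path.length_cons]
    -- Either the arrow prolongs the shortest path, or it retraces its last arrow.
    by_cases h : vdist i l = vdist i j + 1
    · refine ⟨m, ?_, by omega⟩
      rw [← word_cons, eq_geodesic ((geodesic i j).cons a) (by
        rw [Path.length_cons, length_geodesic, h])]
    · have h' : vdist i l + 1 = vdist i j := by
        simp only [vdist_def] at *
        omega
      obtain ⟨b⟩ := nonempty_arrow ha.symm
      -- The shortest path to `j` ends with the reverse `b` of `a`, and `b a = e_l c` produces one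
      -- more power of `c`.
      refine ⟨m + 1, ?_, by omega⟩
      rw [← eq_geodesic ((geodesic i l).cons b) (by
        rw [Path.length_cons, length_geodesic, h']), word_cons, mul_assoc (word k _),
        arrow_mul_arrow, ← mul_assoc (word k _), word_mul_vertex, pow_succ', mul_assoc]

theorem word_mem_cycIdeal {i j : Symmetrify (TypeA n)} (p : Path i j)
    (h : p.length ≠ vdist i j) : word k p ∈ cycIdeal k n := by
  obtain ⟨m, hm, hl⟩ := exists_word_eq k p
  obtain ⟨m, rfl⟩ := Nat.exists_eq_succ_of_ne_zero (n := m) (by omega)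
  rw [hm, pow_succ, ← mul_assoc]
  exact TwoSidedIdeal.mul_mem_left _ _ _ (central_mem_cycIdeal k n)

open Polynomial in
/-- The elements of `e_i Π e_j` are multiples of the shortest path by polynomials in the central
element. -/
theorem exists_vertex_mul_mul_vertex_eq (i j : Symmetrify (TypeA n)) (x : PiA k n) :
    ∃ q : k[X], vertex k i * x * vertex k j = word k (geodesic i j) * aeval (central k n) q := by
  induction mem_span_word k x using Submodule.span_induction with
  | mem w hw =>
    obtain ⟨a, b, p, rfl⟩ := hw
    by_cases ha : i = a
    · by_cases hb : b = j
      · subst ha hb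
        obtain ⟨m, hm, -⟩ := exists_word_eq k p
        exact ⟨X ^ m, by rw [vertex_mul_word, word_mul_vertex, hm, map_pow, aeval_X]⟩
      · exact ⟨0, by rw [mul_assoc, word_mul_vertex_of_ne k p hb, map_zero, mul_zero, mul_zero]⟩
    · exact ⟨0, by rw [vertex_mul_word_of_ne k p ha, map_zero, mul_zero, zero_mul]⟩
  | zero => exact ⟨0, by rw [map_zero, mul_zero, mul_zero, zero_mul]⟩
  | add x y _ _ hx hy =>
    obtain ⟨q, hq⟩ := hx
    obtain ⟨r, hr⟩ := hy
    exact ⟨q + r, by rw [mul_add, add_mul, hq, hr, map_add, mul_add]⟩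
  | smul r x _ hx =>
    obtain ⟨q, hq⟩ := hx
    exact ⟨r • q, by rw [mul_smul_comm, smul_mul_assoc, hq, map_smul, mul_smul_comm]⟩

/-- An ideal contains a shortest path as soon as it does modulo `I_cyc`. -/
theorem word_mem_of_mem_sup {i j : Symmetrify (TypeA n)} {I : TwoSidedIdeal (PiA k n)}
    (h : word k (geodesic i j) ∈ I ⊔ cycIdeal k n) : word k (geodesic i j) ∈ I := by
  obtain ⟨y, hy, z, hz, hyz⟩ := TwoSidedIdeal.mem_sup.1 h
  obtain ⟨x, rfl⟩ := (mem_cycIdeal_iff k z).1 hz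
  obtain ⟨q, hq⟩ := exists_vertex_mul_mul_vertex_eq k i j x
  exact mem_of_add_central_mul_eq I (central_mul k) (isNilpotent_central k n) hy hyz
    (vertex_mul_word k _) (word_mul_vertex k _) hq

end PiA

/-! ### Uniserial modules -/

namespace PiA

open Quiver TypeA

variable (k : Type u) [Field k] {n : ℕ}

/-- The vertices of the shortest path from `i` to `j`. -/
abbrev Between (i j : Symmetrify (TypeA n)) : Type := {a : Symmetrify (TypeA n) // Passes i j a a}

theorem passes_left (i j : Symmetrify (TypeA n)) : Passes i j i i := by
  simp only [Passes, vdist_def]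
  omega

theorem passes_right (i j : Symmetrify (TypeA n)) : Passes i j j j := by
  simp only [Passes, vdist_def]
  omega

/-- The matrix unit at `(a, b)`, or zero if the shortest path from `i` to `j` does not pass through
`a` and then through `b`. -/
def unitMatrix (i j a b : Symmetrify (TypeA n)) : Matrix (Between i j) (Between i j) k :=
  Matrix.of fun u v => if u.1 = a ∧ v.1 = b ∧ Passes i j a b then 1 else 0

theorem unitMatrix_apply (i j a b : Symmetrify (TypeA n)) (u v : Between i j) :
    unitMatrix k i j a b u v = if u.1 = a ∧ v.1 = b ∧ Passes i j a b then 1 else 0 := rfl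

theorem unitMatrix_mul_of_ne (i j a : Symmetrify (TypeA n)) {b b' : Symmetrify (TypeA n)}
    (c : Symmetrify (TypeA n)) (h : b ≠ b') :
    unitMatrix k i j a b * unitMatrix k i j b' c = 0 := by
  ext u v
  rw [Matrix.mul_apply, Matrix.zero_apply]
  refine Finset.sum_eq_zero fun w _ => ?_
  rw [unitMatrix_apply, unitMatrix_apply]
  by_cases hw : w.1 = b
  · rw [if_neg (fun h' : w.1 = b' ∧ _ => h (hw.symm.trans h'.1)), mul_zero]
  · rw [if_neg (fun h' : u.1 = a ∧ w.1 = b ∧ _ => hw h'.2.1), zero_mul]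

/-- Backtracking gives zero, which is multiplication of paths modulo `I_cyc`. When `b` lies between
`a` and `c`, passing through `a` then `c` already includes passing through `b`. -/
theorem unitMatrix_mul (i j a b c : Symmetrify (TypeA n)) :
    unitMatrix k i j a b * unitMatrix k i j b c =
      if vdist a b + vdist b c = vdist a c then unitMatrix k i j a c else 0 := by
  have key : (Passes i j a c ∧ vdist a b + vdist b c = vdist a c) ↔
      Passes i j b b ∧ Passes i j a b ∧ Passes i j b c := by
    simp only [Passes, vdist_def]
    omega
  ext u v
  rw [Matrix.mul_apply]
  by_cases hb : Passes i j b b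
  · rw [Finset.sum_eq_single ⟨b, hb⟩]
    · split_ifs with h
      · simp only [unitMatrix_apply]
        by_cases h1 : u.1 = a <;> by_cases h2 : v.1 = c <;> by_cases h3 : Passes i j a b <;>
          by_cases h4 : Passes i j b c <;> by_cases h5 : Passes i j a c <;>
          simp_all
      · simp only [unitMatrix_apply, Matrix.zero_apply]
        by_cases h1 : u.1 = a <;> by_cases h2 : v.1 = c <;> by_cases h3 : Passes i j a b <;>
          by_cases h4 : Passes i j b c <;>
          simp_all
    · intro w _ hw
      rw [unitMatrix_apply, if_neg, zero_mul]
      exact fun h => hw (Subtype.ext h.2.1)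
    · exact fun h => absurd (Finset.mem_univ _) h
  · rw [Finset.sum_eq_zero]
    · split_ifs with h
      · rw [unitMatrix_apply, if_neg]
        exact fun h' => hb (key.1 ⟨h'.2.2, h⟩).1
      · rfl
    · intro w _
      rw [unitMatrix_apply, if_neg, zero_mul]
      rintro ⟨-, h, -⟩
      exact hb (h ▸ w.2)

theorem sum_unitMatrix (i j : Symmetrify (TypeA n)) :
    ∑ a : Symmetrify (TypeA n), unitMatrix k i j a a = 1 := by
  ext u v
  rw [Matrix.sum_apply, Finset.sum_eq_single u.1, unitMatrix_apply, Matrix.one_apply]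
  · by_cases h : u = v
    · rw [if_pos ⟨rfl, congrArg Subtype.val h.symm, u.2⟩, if_pos h]
    · rw [if_neg fun h' => h (Subtype.ext h'.2.1.symm), if_neg h]
  · intro a _ ha
    rw [unitMatrix_apply, if_neg]
    exact fun h => ha h.1.symm
  · exact fun h => absurd (Finset.mem_univ _) h

/-- The images of the vertices and of the arrows under the representation `rep`. -/
def repGen (i j : Symmetrify (TypeA n)) :
    PathAlgebra.Gen (Symmetrify (TypeA n)) → Matrix (Between i j) (Between i j) k
  | .vertex a => unitMatrix k i j a a
  | @PathAlgebra.Gen.arrow _ _ a b _ => unitMatrix k i j a b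

/-- The representation of the path algebra on the uniserial module with top `j` and socle `i`. -/
noncomputable def pathRep (i j : Symmetrify (TypeA n)) :
    PathAlgebra k (Symmetrify (TypeA n)) →ₐ[k] Matrix (Between i j) (Between i j) k :=
  RingQuot.liftAlgHom k ⟨FreeAlgebra.lift k (repGen k i j), fun x y h => by
    cases h with
    | idem a =>
      simp only [map_mul, FreeAlgebra.lift_ι_apply, repGen, unitMatrix_mul]
      rw [if_pos (by simp [vdist_def])]
    | orth a b h =>
      simp only [map_mul, FreeAlgebra.lift_ι_apply, repGen, map_zero]
      exact unitMatrix_mul_of_ne k i j a b h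
    | sum_eq_one =>
      simp only [map_sum, FreeAlgebra.lift_ι_apply, repGen, map_one]
      exact sum_unitMatrix k i j
    | source a =>
      simp only [map_mul, FreeAlgebra.lift_ι_apply, repGen, unitMatrix_mul]
      rw [if_pos (by simp [vdist_def])]
    | target a =>
      simp only [map_mul, FreeAlgebra.lift_ι_apply, repGen, unitMatrix_mul]
      rw [if_pos (by simp [vdist_def])]⟩

theorem pathRep_vertex (i j a : Symmetrify (TypeA n)) :
    pathRep k i j (PathAlgebra.vertex k a) = unitMatrix k i j a a := by
  rw [pathRep, PathAlgebra.vertex, RingQuot.liftAlgHom_mkAlgHom_apply, FreeAlgebra.lift_ι_apply]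
  rfl

theorem pathRep_arrow (i j : Symmetrify (TypeA n)) {a b : Symmetrify (TypeA n)} (e : a ⟶ b) :
    pathRep k i j (PathAlgebra.arrow k e) = unitMatrix k i j a b := by
  rw [pathRep, PathAlgebra.arrow, RingQuot.liftAlgHom_mkAlgHom_apply, FreeAlgebra.lift_ι_apply]
  rfl

theorem unitMatrix_mul_unitMatrix_of_arrow (i j : Symmetrify (TypeA n))
    {a b : Symmetrify (TypeA n)} (e : a ⟶ b) :
    unitMatrix k i j a b * unitMatrix k i j b a = 0 := by
  have := height_arrow e
  rw [unitMatrix_mul, if_neg]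
  simp only [vdist_def]
  omega

theorem pathRep_arrow_mul_arrow (i j : Symmetrify (TypeA n)) {a b : Symmetrify (TypeA n)}
    (e : a ⟶ b) (f : b ⟶ a) :
    pathRep k i j (PathAlgebra.arrow k e) * pathRep k i j (PathAlgebra.arrow k f) = 0 := by
  rw [pathRep_arrow, pathRep_arrow, unitMatrix_mul_unitMatrix_of_arrow k i j e]

/-- The representation of `Π` on the uniserial module with top `j` and socle `i`. -/
noncomputable def rep (i j : Symmetrify (TypeA n)) :
    PiA k n →ₐ[k] Matrix (Between i j) (Between i j) k :=
  RingQuot.liftAlgHom k ⟨pathRep k i j, fun x y h => by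
    cases h
    simp only [map_sum, map_sub, map_mul, map_zero]
    refine Finset.sum_eq_zero fun a _ => Finset.sum_eq_zero fun b _ =>
      Finset.sum_eq_zero fun e _ => ?_
    exact (congrArg₂ (· - ·) (pathRep_arrow_mul_arrow k i j e.toPos e.toNeg)
      (pathRep_arrow_mul_arrow k i j e.toNeg e.toPos)).trans (sub_zero 0)⟩

theorem rep_vertex (i j a : Symmetrify (TypeA n)) :
    rep k i j (vertex k a) = unitMatrix k i j a a := by
  rw [rep, vertex, RingQuot.liftAlgHom_mkAlgHom_apply, pathRep_vertex]

theorem rep_arrow (i j : Symmetrify (TypeA n)) {a b : Symmetrify (TypeA n)} (e : a ⟶ b) :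
    rep k i j (arrow k n e) = unitMatrix k i j a b := by
  rw [rep, arrow, RingQuot.liftAlgHom_mkAlgHom_apply, pathRep_arrow]

theorem rep_arrow_mul_arrow (i j : Symmetrify (TypeA n)) {a b : Symmetrify (TypeA n)}
    (e : a ⟶ b) (f : b ⟶ a) : rep k i j (arrow k n e) * rep k i j (arrow k n f) = 0 := by
  rw [rep_arrow, rep_arrow, unitMatrix_mul_unitMatrix_of_arrow k i j e]

theorem rep_central (i j : Symmetrify (TypeA n)) : rep k i j (central k n) = 0 := by
  rw [central]
  simp only [map_sum, map_mul]
  exact Finset.sum_eq_zero fun a _ => Finset.sum_eq_zero fun b _ =>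
    Finset.sum_eq_zero fun e _ => rep_arrow_mul_arrow k i j e.toPos e.toNeg

theorem rep_word (i j : Symmetrify (TypeA n)) {a b : Symmetrify (TypeA n)} (p : Path a b) :
    rep k i j (word k p) = if p.length = vdist a b then unitMatrix k i j a b else 0 := by
  induction p with
  | nil => rw [word_nil, rep_vertex, if_pos (by simp [vdist_def])]
  | @cons b c p e ih =>
    have he := height_arrow e
    have hp := vdist_le_length p
    rw [word_cons, map_mul, ih, rep_arrow, Path.length_cons]
    by_cases h : p.length = vdist a b
    · rw [if_pos h, unitMatrix_mul]
      refine if_congr ?_ rfl rfl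
      simp only [vdist_def] at *
      omega
    · rw [if_neg h, zero_mul, if_neg]
      simp only [vdist_def] at *
      omega

/-! ### Coordinates modulo `I_cyc` -/

/-- The coefficient of the shortest path from `i` to `j` in an element of `Π`. -/
noncomputable def coord (i j : Symmetrify (TypeA n)) (x : PiA k n) : k :=
  rep k i j x ⟨i, passes_left i j⟩ ⟨j, passes_right i j⟩

theorem coord_add (i j : Symmetrify (TypeA n)) (x y : PiA k n) :
    coord k i j (x + y) = coord k i j x + coord k i j y := by
  rw [coord, map_add]
  rfl

theorem coord_smul (i j : Symmetrify (TypeA n)) (r : k) (x : PiA k n) :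
    coord k i j (r • x) = r * coord k i j x := by
  rw [coord, map_smul]
  rfl

theorem coord_zero (i j : Symmetrify (TypeA n)) : coord k i j (0 : PiA k n) = 0 := by
  rw [coord, map_zero]
  rfl

theorem coord_word (i j : Symmetrify (TypeA n)) {a b : Symmetrify (TypeA n)} (p : Path a b) :
    coord k i j (word k p) = if i = a ∧ j = b ∧ p.length = vdist a b then 1 else 0 := by
  rw [coord, rep_word]
  by_cases h : p.length = vdist a b
  · rw [if_pos h, unitMatrix_apply]
    refine if_congr (and_congr_right fun h1 => and_congr_right fun h2 => ?_) rfl rfl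
    have h1 : i = a := h1
    have h2 : j = b := h2
    subst h1 h2
    refine iff_of_true ?_ h
    simp only [Passes, vdist_def]
    omega
  · rw [if_neg h, if_neg (fun h' : i = a ∧ j = b ∧ _ => h h'.2.2), Matrix.zero_apply]

/-- An entry does not depend on the ambient pair `(i, j)`, so a single family of coefficients
describes all these representations. -/
theorem rep_apply (i j : Symmetrify (TypeA n)) (x : PiA k n) (u v : Between i j) :
    rep k i j x u v = if Passes i j u.1 v.1 then coord k u.1 v.1 x else 0 := by
  induction mem_span_word k x using Submodule.span_induction with
  | mem w hw =>
    obtain ⟨a, b, p, rfl⟩ := hw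
    rw [rep_word, coord_word]
    by_cases h : p.length = vdist a b
    · rw [if_pos h, unitMatrix_apply]
      by_cases h1 : u.1 = a <;> by_cases h2 : v.1 = b <;> simp_all
    · simp [h]
  | zero => simp [coord_zero]
  | add x y _ _ hx hy =>
    rw [map_add, Matrix.add_apply, hx, hy, coord_add]
    split_ifs <;> simp
  | smul r x _ hx =>
    rw [map_smul, Matrix.smul_apply, hx, coord_smul]
    split_ifs <;> simp

theorem coord_mul (i j : Symmetrify (TypeA n)) (x y : PiA k n) :
    coord k i j (x * y) = ∑ w : Between i j, coord k i w.1 x * coord k w.1 j y := by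
  rw [coord, map_mul, Matrix.mul_apply]
  refine Finset.sum_congr rfl fun w _ => ?_
  have hw := w.2
  rw [rep_apply, rep_apply, if_pos, if_pos]
  · simp only [Passes, vdist_def] at *
    omega
  · simp only [Passes, vdist_def] at *
    omega

theorem coord_central_mul (i j : Symmetrify (TypeA n)) (x : PiA k n) :
    coord k i j (central k n * x) = 0 := by
  rw [coord, map_mul, rep_central, zero_mul]
  rfl

theorem exists_vertex_mul_mul_vertex_eq_coord (i j : Symmetrify (TypeA n)) (x : PiA k n) :
    ∃ y, vertex k i * x * vertex k j =
      coord k i j x • word k (geodesic i j) + central k n * y := by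
  induction mem_span_word k x using Submodule.span_induction with
  | mem w hw =>
    obtain ⟨a, b, p, rfl⟩ := hw
    rw [coord_word]
    by_cases ha : i = a
    · by_cases hb : j = b
      · subst ha hb
        rw [vertex_mul_word, word_mul_vertex]
        by_cases h : p.length = vdist i j
        · refine ⟨0, ?_⟩
          rw [if_pos ⟨rfl, rfl, h⟩, one_smul, mul_zero, add_zero, ← eq_geodesic p h]
        · obtain ⟨y, hy⟩ := (mem_cycIdeal_iff k _).1 (word_mem_cycIdeal k p h)
          exact ⟨y, by rw [if_neg (fun h' => h h'.2.2), zero_smul, zero_add, hy]⟩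
      · refine ⟨0, ?_⟩
        rw [if_neg (fun h => hb h.2.1), mul_assoc, word_mul_vertex_of_ne k p (Ne.symm hb), mul_zero,
          zero_smul, mul_zero, zero_add]
    · refine ⟨0, ?_⟩
      rw [if_neg (fun h => ha h.1), vertex_mul_word_of_ne k p ha, zero_mul, zero_smul, mul_zero,
        zero_add]
  | zero => exact ⟨0, by rw [coord_zero, zero_smul, mul_zero, mul_zero, zero_mul, zero_add]⟩
  | add x y _ _ hx hy =>
    obtain ⟨z, hz⟩ := hx
    obtain ⟨w, hw⟩ := hy
    exact ⟨z + w, by rw [mul_add, add_mul, hz, hw, coord_add, add_smul, mul_add, add_add_add_comm]⟩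
  | smul r x _ hx =>
    obtain ⟨z, hz⟩ := hx
    exact ⟨r • z, by
      rw [mul_smul_comm, smul_mul_assoc, hz, coord_smul, mul_smul, mul_smul_comm, smul_add]⟩

theorem sum_vertex_mul_mul_vertex (x : PiA k n) :
    ∑ i : Symmetrify (TypeA n), ∑ j : Symmetrify (TypeA n), vertex k i * x * vertex k j = x := by
  simp only [← Finset.mul_sum, ← Finset.sum_mul, sum_vertex, mul_one, one_mul]

theorem smul_mem_ideal (I : TwoSidedIdeal (PiA k n)) (r : k) {x : PiA k n} (hx : x ∈ I) :
    r • x ∈ I := by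
  rw [Algebra.smul_def]
  exact I.mul_mem_left _ _ hx

/-- Multiplying by `e_i` and `e_j` isolates one shortest path modulo `c`, and its nonzero
coefficient can be inverted in `k`. -/
theorem mem_iff_of_cycIdeal_le {J : TwoSidedIdeal (PiA k n)} (hJ : cycIdeal k n ≤ J)
    (x : PiA k n) :
    x ∈ J ↔ ∀ i j : Symmetrify (TypeA n), coord k i j x ≠ 0 → word k (geodesic i j) ∈ J := by
  have hc (y : PiA k n) : central k n * y ∈ J :=
    J.mul_mem_right _ _ (hJ (central_mem_cycIdeal k n))
  constructor
  · intro hx i j hij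
    obtain ⟨y, hy⟩ := exists_vertex_mul_mul_vertex_eq_coord k i j x
    have h1 : coord k i j x • word k (geodesic i j) ∈ J := by
      refine (add_mem_cancel_right (hc y)).1 ?_
      rw [← hy]
      exact J.mul_mem_right _ _ (J.mul_mem_left _ _ hx)
    have h2 := smul_mem_ideal k J (coord k i j x)⁻¹ h1
    rwa [smul_smul, inv_mul_cancel₀ hij, one_smul] at h2
  · intro h
    rw [← sum_vertex_mul_mul_vertex k x]
    refine sum_mem fun i _ => sum_mem fun j _ => ?_
    obtain ⟨y, hy⟩ := exists_vertex_mul_mul_vertex_eq_coord k i j x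
    rw [hy]
    refine J.add_mem ?_ (hc y)
    by_cases hij : coord k i j x = 0
    · rw [hij, zero_smul]
      exact J.zero_mem
    · exact smul_mem_ideal k J _ (h i j hij)

theorem word_mem_of_passes {J : TwoSidedIdeal (PiA k n)} {i j a b : Symmetrify (TypeA n)}
    (h : Passes i j a b) (hab : word k (geodesic a b) ∈ J) : word k (geodesic i j) ∈ J := by
  rw [← eq_geodesic ((geodesic i a).comp ((geodesic a b).comp (geodesic b j))) (by
    rw [Path.length_comp, Path.length_comp, length_geodesic, length_geodesic, length_geodesic,
      ← add_assoc]
    exact h), word_comp, word_comp]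
  exact J.mul_mem_left _ _ (J.mul_mem_right _ _ hab)

/-! ### The bricks -/

/-- The uniserial module with top `j` and socle `i`. -/
def Uniserial (i j : Symmetrify (TypeA n)) : Type u := Between i j → k

namespace Uniserial

variable {k} (i j : Symmetrify (TypeA n))

instance instAddCommGroup : AddCommGroup (Uniserial k i j) :=
  inferInstanceAs (AddCommGroup (Between i j → k))

noncomputable instance instModule : Module (PiA k n) (Uniserial k i j) :=
  Module.compHom (Between i j → k)
    ((Matrix.toLinAlgEquiv' (R := k) (n := Between i j)).toAlgHom.comp (rep k i j)).toRingHom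

theorem smul_def (x : PiA k n) (v : Uniserial k i j) :
    x • v = (rep k i j x).mulVec v := rfl

variable (k) in
/-- The generator of the uniserial module. -/
def top : Uniserial k i j := Pi.single (M := fun _ : Between i j => k) ⟨j, passes_right i j⟩ 1

theorem smul_top (x : PiA k n) (u : Between i j) :
    (x • top k i j) u = coord k u.1 j x := by
  rw [smul_def, top, Matrix.mulVec_single_one, Matrix.col_apply, rep_apply, if_pos]
  have := u.2
  simp only [Passes, vdist_def] at *
  omega

theorem exists_eq_smul_top (v : Uniserial k i j) : ∃ x : PiA k n, v = x • top k i j := by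
  refine ⟨∑ u : Between i j, v u • word k (geodesic u.1 j), funext fun w => ?_⟩
  have hsum (s : Finset (Between i j)) :
      coord k w.1 j (∑ u ∈ s, v u • word k (geodesic u.1 j)) =
        ∑ u ∈ s, v u * coord k w.1 j (word k (geodesic u.1 j)) := by
    induction s using Finset.cons_induction with
    | empty => exact coord_zero k _ _
    | cons a s ha ih => rw [Finset.sum_cons, Finset.sum_cons, coord_add, coord_smul, ih]
  rw [smul_top, hsum, Finset.sum_eq_single w]
  · rw [coord_word, if_pos ⟨rfl, rfl, length_geodesic _ _⟩, mul_one]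
  · intro u _ hu
    rw [coord_word, if_neg, mul_zero]
    exact fun h => hu (Subtype.ext h.1.symm)
  · exact fun h => absurd (Finset.mem_univ _) h

theorem vertex_smul_top : vertex k j • top k i j = top k i j := by
  funext u
  rw [smul_top, ← word_nil, coord_word, top, Pi.single_apply]
  refine if_congr ?_ rfl rfl
  simp [vdist_def, Subtype.ext_iff]

theorem central_smul (v : Uniserial k i j) : central k n • v = 0 := by
  rw [smul_def, rep_central]
  exact Matrix.zero_mulVec _

theorem exists_end_apply_eq (f : Module.End (PiA k n) (Uniserial k i j)) :
    ∃ r : k, ∀ v, f v = algebraMap k (PiA k n) r • v := by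
  obtain ⟨x, hx⟩ := exists_eq_smul_top i j (f (top k i j))
  obtain ⟨y, hy⟩ := exists_vertex_mul_mul_vertex_eq_coord k j j x
  have hf : f (top k i j) = algebraMap k (PiA k n) (coord k j j x) • top k i j := by
    -- The generator is fixed by `e_j`, hence so is its image; and `e_j Π e_j` acts by scalars on
    -- it, because `c` acts as zero.
    calc f (top k i j) = vertex k j • f (top k i j) := by rw [← map_smul, vertex_smul_top]
      _ = (vertex k j * x * vertex k j) • top k i j := by
        rw [hx, mul_smul, mul_smul, vertex_smul_top]
      _ = _ := by
        rw [hy, add_smul, mul_smul (central k n), central_smul, add_zero, geodesic_self, word_nil,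
          Algebra.smul_def, mul_smul, vertex_smul_top]
  refine ⟨coord k j j x, fun v => ?_⟩
  obtain ⟨z, rfl⟩ := exists_eq_smul_top i j v
  rw [map_smul, hf, ← mul_smul, ← mul_smul, Algebra.commutes]

theorem isUnit_end {f : Module.End (PiA k n) (Uniserial k i j)} (hf : f ≠ 0) : IsUnit f := by
  obtain ⟨r, hr⟩ := exists_end_apply_eq i j f
  have hr0 : r ≠ 0 := by
    rintro rfl
    exact hf (LinearMap.ext fun v => by rw [hr, map_zero, zero_smul, LinearMap.zero_apply])
  refine (Module.End.isUnit_iff f).2 ⟨fun v w h => ?_, fun v =>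
    ⟨algebraMap k (PiA k n) r⁻¹ • v, ?_⟩⟩
  · have h' := congrArg (fun v => algebraMap k (PiA k n) r⁻¹ • v) h
    simpa only [hr, ← mul_smul, ← map_mul, inv_mul_cancel₀ hr0, map_one, one_smul] using h'
  · rw [hr, ← mul_smul, ← map_mul, mul_inv_cancel₀ hr0, map_one, one_smul]

theorem isBrick : IsBrick (PiA k n) (ModuleCat.of (PiA k n) (Uniserial k i j)) := by
  refine ⟨⟨{top k i j}, eq_top_iff.2 fun v _ => ?_⟩, ?_, fun f hf => isUnit_end i j hf⟩
  · obtain ⟨x, rfl⟩ := exists_eq_smul_top i j v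
    exact Submodule.smul_mem _ _ (Submodule.subset_span (by simp))
  · refine ⟨1, 0, fun h => ?_⟩
    have h1 : top k i j = 0 := LinearMap.congr_fun h (top k i j)
    have h2 := congrFun h1 ⟨j, passes_right i j⟩
    rw [top, Pi.single_eq_same] at h2
    exact one_ne_zero h2

/-- The path from `i` to `j` moves the generator to a nonzero vector. If some element of `J` acts
nontrivially, then `J` contains a subpath of that path, hence the path itself. -/
theorem annihilatedBy_iff {J : TwoSidedIdeal (PiA k n)} (hJ : cycIdeal k n ≤ J) :
    AnnihilatedBy J (ModuleCat.of (PiA k n) (Uniserial k i j)) ↔ word k (geodesic i j) ∉ J := by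
  constructor
  · intro h hmem
    have h1 := congrFun (h _ hmem (top k i j)) ⟨i, passes_left i j⟩
    have h2 := smul_top i j (word k (geodesic i j)) ⟨i, passes_left i j⟩
    rw [coord_word, if_pos ⟨rfl, rfl, length_geodesic _ _⟩] at h2
    exact one_ne_zero (h2.symm.trans h1)
  · intro h x hx v
    have hrep : rep k i j x = 0 := by
      ext u w
      rw [rep_apply, Matrix.zero_apply]
      split_ifs with hp
      · by_contra hne
        exact h (word_mem_of_passes k hp ((mem_iff_of_cycIdeal_le k hJ x).1 hx _ _ hne))
      · rfl
    change (rep k i j x).mulVec v = 0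
    rw [hrep]
    exact Matrix.zero_mulVec _

end Uniserial

end PiA

/-! ### Ideals and congruences of the preprojective algebra of type `A` -/

namespace PiA

open Quiver TypeA

variable (k : Type u) [Field k] {n : ℕ}

/-! ### The quotient by `I_cyc` -/

variable (n) in
theorem toBar_surjective : Function.Surjective (toBar k n) := RingCon.mk'_surjective _

theorem toBar_eq_zero_iff (x : PiA k n) : toBar k n x = 0 ↔ x ∈ cycIdeal k n := by
  rw [TwoSidedIdeal.mem_iff, ← map_zero (toBar k n)]
  exact RingCon.eq _

theorem toBar_smul (r : k) (x : PiA k n) : toBar k n (r • x) = r • toBar k n x := rfl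

theorem exists_eq_central_mul_of_toBar_eq_zero (x : PiA k n) (hx : toBar k n x = 0) :
    ∃ y, x = central k n * y :=
  (mem_cycIdeal_iff k x).1 ((toBar_eq_zero_iff k x).1 hx)

variable {k} in
/-- The preimage in `Π` of an ideal of `Π / I_cyc`. -/
noncomputable def pullback (I : TwoSidedIdeal (PiABar k n)) : TwoSidedIdeal (PiA k n) :=
  I.comap (toBar k n)

theorem mem_pullback {I : TwoSidedIdeal (PiABar k n)} {x : PiA k n} :
    x ∈ pullback I ↔ toBar k n x ∈ I := Iff.rfl

theorem pullback_mono {I J : TwoSidedIdeal (PiABar k n)} (h : I ≤ J) : pullback I ≤ pullback J :=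
  fun _ hx => h hx

theorem cycIdeal_le_pullback (I : TwoSidedIdeal (PiABar k n)) : cycIdeal k n ≤ pullback I :=
  fun x hx => (mem_pullback k).2 ((toBar_eq_zero_iff k x).2 hx ▸ I.zero_mem)

theorem eta_pullback_rel_iff (I : TwoSidedIdeal (PiABar k n)) (T U : TorsionClass (PiA k n)) :
    (eta (pullback I)).r T U ↔ (eta I).r (T.restrict (toBar k n)) (U.restrict (toBar k n)) := by
  have h := eta_rel_iff_of_surjective (toBar k n) (toBar_surjective k n)
    (fun x => mem_pullback k (I := I) (x := x)) T U
  exact h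

theorem pullback_map (I : TwoSidedIdeal (PiA k n)) :
    pullback (I.map (toBar k n)) = I ⊔ cycIdeal k n := by
  refine TwoSidedIdeal.ext fun x => ?_
  rw [mem_pullback, TwoSidedIdeal.mem_sup]
  have h := mem_map_iff_of_surjective (toBar k n) (toBar_surjective k n) I (toBar k n x)
  refine Iff.trans h ?_
  constructor
  · rintro ⟨y, hy, hxy⟩
    refine ⟨y, hy, x - y, (TwoSidedIdeal.rel_iff _ x y).1 ((RingCon.eq _).1 hxy.symm), ?_⟩
    exact add_sub_cancel y x
  · rintro ⟨y, hy, z, hz, rfl⟩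
    refine ⟨y, hy, ?_⟩
    rw [map_add, (toBar_eq_zero_iff k z).2 hz, add_zero]

/-! ### Annihilators of bricks -/

variable (n) in
theorem brickIdeal_eq : brickIdeal (PiA k n) = cycIdeal k n := by
  refine le_antisymm (fun x hx => ?_) (TwoSidedIdeal.span_le.2 ?_)
  · have hx' : ∀ S : ModuleCat.{u} (PiA k n), IsBrick (PiA k n) S → ∀ s : S, x • s = 0 :=
      (TwoSidedIdeal.mem_mk' ..).1 hx
    -- The coefficient at `(i, j)` is an entry of `x` applied to the generator of the uniserial
    -- brick, so it vanishes.
    refine (mem_iff_of_cycIdeal_le k le_rfl x).2 fun i j h => absurd ?_ h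
    have h1 : x • Uniserial.top k i j = 0 := hx' _ (Uniserial.isBrick i j) (Uniserial.top k i j)
    rw [← Uniserial.smul_top i j x ⟨i, passes_left i j⟩, h1]
    rfl
  · rintro _ ⟨i, j, a, b, rfl⟩
    refine (TwoSidedIdeal.mem_mk' ..).2 fun S hS s => ?_
    rw [arrow_mul_arrow, mul_smul]
    let l : Module.End (PiA k n) S :=
      { toFun := fun m => central k n • m
        map_add' := smul_add _
        map_smul' := fun a m => by simp only [RingHom.id_apply, ← mul_smul, central_mul] }
    -- A nonzero endomorphism of a brick is a unit, whereas `l` is nilpotent.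
    have hl : l = 0 := by
      by_contra hl
      obtain ⟨r, hr⟩ := isNilpotent_central k n
      have hpow (m : ℕ) (v : S) : (l ^ m) v = central k n ^ m • v := by
        induction m generalizing v with
        | zero => rw [pow_zero, pow_zero, one_smul, Module.End.one_apply]
        | succ m ih => rw [pow_succ, pow_succ, Module.End.mul_apply, ih, mul_smul]; rfl
      have hz : l ^ r = 0 := LinearMap.ext fun v => by rw [hpow, hr, zero_smul]; rfl
      have := hS.2.1
      exact not_isUnit_zero (hz ▸ (hS.2.2 l hl).pow r)
    have hs : central k n • s = 0 := LinearMap.congr_fun hl s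
    rw [hs, smul_zero]

/-! ### Ideals as upper sets of paths -/

/-- The ideal of the elements of `Π` whose shortest paths lie in an upper set. -/
noncomputable def idealOfUpperSet (S : UpperSet (PathsA n)) : TwoSidedIdeal (PiA k n) :=
  TwoSidedIdeal.mk' {x | ∀ i j, coord k i j x ≠ 0 → geodesicPath i j ∈ S}
    (fun i j h => absurd (coord_zero k i j) h)
    (fun {x y} hx hy i j h => by
      rw [coord_add] at h
      by_cases h' : coord k i j x = 0
      · rw [h', zero_add] at h
        exact hy i j h
      · exact hx i j h')
    (fun {x} hx i j h => hx i j fun h' => h (by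
      rw [← neg_one_smul k x, coord_smul, h', mul_zero]))
    (fun {x y} hy i j h => by
      rw [coord_mul] at h
      obtain ⟨w, -, hw⟩ := Finset.exists_ne_zero_of_sum_ne_zero h
      refine S.upper (geodesicPath_le_iff.2 ?_) (hy w.1 j (right_ne_zero_of_mul hw))
      have := w.2
      simp only [Passes, vdist_def] at *
      omega)
    (fun {x y} hx i j h => by
      rw [coord_mul] at h
      obtain ⟨w, -, hw⟩ := Finset.exists_ne_zero_of_sum_ne_zero h
      refine S.upper (geodesicPath_le_iff.2 ?_) (hx i w.1 (left_ne_zero_of_mul hw))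
      have := w.2
      simp only [Passes, vdist_def] at *
      omega)

theorem mem_idealOfUpperSet {S : UpperSet (PathsA n)} {x : PiA k n} :
    x ∈ idealOfUpperSet k S ↔ ∀ i j, coord k i j x ≠ 0 → geodesicPath i j ∈ S :=
  TwoSidedIdeal.mem_mk' ..

theorem word_mem_idealOfUpperSet {S : UpperSet (PathsA n)} {i j : Symmetrify (TypeA n)} :
    word k (geodesic i j) ∈ idealOfUpperSet k S ↔ geodesicPath i j ∈ S := by
  rw [mem_idealOfUpperSet]
  constructor
  · intro h
    refine h i j ?_
    rw [coord_word, if_pos ⟨rfl, rfl, length_geodesic i j⟩]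
    exact one_ne_zero
  · intro h a b hab
    rw [coord_word] at hab
    obtain ⟨rfl, rfl, -⟩ := of_not_not fun h' => hab (if_neg h')
    exact h

theorem cycIdeal_le_idealOfUpperSet (S : UpperSet (PathsA n)) :
    cycIdeal k n ≤ idealOfUpperSet k S := by
  intro x hx
  obtain ⟨y, rfl⟩ := (mem_cycIdeal_iff k x).1 hx
  exact (mem_idealOfUpperSet k).2 fun i j h => absurd (coord_central_mul k i j y) h

/-- The upper set of the paths contained in an ideal of `Π / I_cyc`. -/
noncomputable def upperSetOfIdeal (I : TwoSidedIdeal (PiABar k n)) : UpperSet (PathsA n) where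
  carrier := {p | toBar k n (ofPath k n p) ∈ I}
  upper' := by
    rintro p q ⟨b, c, h⟩ hp
    have hq : ofPath k n q = word k b * (ofPath k n p * word k c) := by
      change word k q.path = word k b * (word k p.path * word k c)
      rw [h, word_comp, word_comp]
    change toBar k n (ofPath k n q) ∈ I
    rw [hq, map_mul, map_mul]
    exact I.mul_mem_left _ _ (I.mul_mem_right _ _ hp)

theorem mem_upperSetOfIdeal {I : TwoSidedIdeal (PiABar k n)} {p : PathsA n} :
    p ∈ upperSetOfIdeal k I ↔ toBar k n (ofPath k n p) ∈ I := Iff.rfl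

theorem le_iff_forall_word {I J : TwoSidedIdeal (PiABar k n)} :
    I ≤ J ↔ ∀ i j : Symmetrify (TypeA n), word k (geodesic i j) ∈ pullback I →
      word k (geodesic i j) ∈ pullback J := by
  refine ⟨fun h i j hij => pullback_mono k h hij, fun h x hx => ?_⟩
  obtain ⟨x, rfl⟩ := toBar_surjective k n x
  refine (mem_pullback k).1
    ((mem_iff_of_cycIdeal_le k (cycIdeal_le_pullback k J) x).2 fun i j hij => h i j ?_)
  exact (mem_iff_of_cycIdeal_le k (cycIdeal_le_pullback k I) x).1
    ((mem_pullback k).2 hx) i j hij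

theorem upperSetOfIdeal_le_iff {I J : TwoSidedIdeal (PiABar k n)} :
    upperSetOfIdeal k J ≤ upperSetOfIdeal k I ↔ I ≤ J := by
  rw [le_iff_forall_word]
  constructor
  · intro h i j hij
    exact (mem_pullback k).2
      (@h (geodesicPath i j) ((mem_pullback k).1 hij))
  · intro h p hp
    have hp' : toBar k n (ofPath k n p) ∈ I := hp
    change toBar k n (ofPath k n p) ∈ J
    rw [ofPath_eq] at hp' ⊢
    exact h _ _ hp'

/-- Gives surjectivity of the correspondence: the ideal built from `S` contains `I_cyc`, so it is
recovered from its image. -/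
theorem upperSetOfIdeal_map (S : UpperSet (PathsA n)) :
    upperSetOfIdeal k ((idealOfUpperSet k S).map (toBar k n)) = S := by
  refine SetLike.ext fun p => ?_
  rw [mem_upperSetOfIdeal, ← mem_pullback, pullback_map,
    sup_eq_left.2 (cycIdeal_le_idealOfUpperSet k S), ofPath_eq, word_mem_idealOfUpperSet,
    ← eq_geodesicPath]

variable (n) in
/-- The ideals of `Π / I_cyc` correspond to the upper sets of non-revisiting paths. -/
noncomputable def idealEquiv : TwoSidedIdeal (PiABar k n) ≃o (UpperSet (PathsA n))ᵒᵈ :=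
  RelIso.ofSurjective
    (OrderEmbedding.ofMapLEIff (fun I => OrderDual.toDual (upperSetOfIdeal k I)) fun _ _ =>
      upperSetOfIdeal_le_iff k)
    fun S => ⟨(idealOfUpperSet k (OrderDual.ofDual S)).map (toBar k n),
      congrArg OrderDual.toDual (upperSetOfIdeal_map k _)⟩

theorem toBar_eq_sum (x : PiA k n) :
    toBar k n x = ∑ i : Symmetrify (TypeA n), ∑ j : Symmetrify (TypeA n),
      coord k i j x • toBar k n (word k (geodesic i j)) := by
  conv_lhs => rw [← sum_vertex_mul_mul_vertex k x]
  rw [map_sum]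
  refine Finset.sum_congr rfl fun i _ => ?_
  rw [map_sum]
  refine Finset.sum_congr rfl fun j _ => ?_
  obtain ⟨y, hy⟩ := exists_vertex_mul_mul_vertex_eq_coord k i j x
  rw [hy, map_add, toBar_smul, (toBar_eq_zero_iff k _).2 ((mem_cycIdeal_iff k _).2 ⟨y, rfl⟩),
    add_zero]

theorem coe_eq_span (I : TwoSidedIdeal (PiABar k n)) :
    (I : Set (PiABar k n)) = Submodule.span k
      ((fun p => toBar k n (ofPath k n p)) '' (upperSetOfIdeal k I : Set (PathsA n))) := by
  refine Set.Subset.antisymm (fun x hx => ?_) fun x hx => ?_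
  · obtain ⟨x, rfl⟩ := toBar_surjective k n x
    rw [toBar_eq_sum]
    refine Submodule.sum_mem _ fun i _ => Submodule.sum_mem _ fun j _ => ?_
    by_cases h : coord k i j x = 0
    · rw [h, zero_smul]
      exact Submodule.zero_mem _
    · refine Submodule.smul_mem _ _ (Submodule.subset_span ⟨geodesicPath i j, ?_, rfl⟩)
      exact (mem_pullback k).1
        ((mem_iff_of_cycIdeal_le k (cycIdeal_le_pullback k I) x).1
          ((mem_pullback k).2 hx) i j h)
  · induction hx using Submodule.span_induction with
    | mem x h =>
      obtain ⟨p, hp, rfl⟩ := h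
      exact hp
    | zero => exact I.zero_mem
    | add x y _ _ hx hy => exact I.add_mem hx hy
    | smul r x _ hx =>
      rw [Algebra.smul_def]
      exact I.mul_mem_left _ _ hx

/-! ### Ideals and algebraic congruences -/

theorem eta_pullback_le_iff {I J : TwoSidedIdeal (PiABar k n)} :
    eta (pullback I) ≤ eta (pullback J) ↔ I ≤ J := by
  refine ⟨fun h => (le_iff_forall_word k).2 fun i j hI => ?_,
    fun h => eta_mono (pullback_mono k h)⟩
  by_contra hJ
  -- A shortest path in `I` but not in `J` gives a uniserial brick killed by the preimage of `J` but
  -- not by that of `I`.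
  exact (Uniserial.annihilatedBy_iff i j (cycIdeal_le_pullback k I)).1
    ((Uniserial.isBrick i j).annihilatedBy_of_eta_le h
      ((Uniserial.annihilatedBy_iff i j (cycIdeal_le_pullback k J)).2 hJ)) hI

theorem eta_pullback_map (I : TwoSidedIdeal (PiA k n)) :
    eta (pullback (I.map (toBar k n))) = eta I := by
  rw [pullback_map]
  exact eta_sup_eq (central_mul k) (isNilpotent_central k n) I _ fun a ha =>
    (mem_cycIdeal_iff k a).1 ha

variable (n) in
/-- The ideals of `Π / I_cyc` correspond to the algebraic congruences of `Π`. -/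
noncomputable def algConEquiv : TwoSidedIdeal (PiABar k n) ≃o AlgCon (PiA k n) :=
  RelIso.ofSurjective
    (OrderEmbedding.ofMapLEIff
      (fun I => (⟨eta (pullback I), _, rfl⟩ : AlgCon (PiA k n))) fun _ _ =>
        eta_pullback_le_iff k)
    (by
      rintro ⟨_, I, rfl⟩
      exact ⟨I.map (toBar k n), Subtype.ext (eta_pullback_map k I)⟩)

variable (n) in
/-- The torsion classes of `Π` and of `Π / I_cyc` correspond to each other. -/
noncomputable def torsEquiv : TorsionClass (PiA k n) ≃o TorsionClass (PiABar k n) :=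
  TorsionClass.restrictOrderIso (toBar k n) (toBar_surjective k n) (central k n) (central_mul k)
    (isNilpotent_central k n) (exists_eq_central_mul_of_toBar_eq_zero k)

theorem eta_eq_iff_sup_eq {I J : TwoSidedIdeal (PiA k n)} :
    eta I = eta J ↔ I ⊔ cycIdeal k n = J ⊔ cycIdeal k n := by
  constructor
  · intro h
    rw [← eta_pullback_map k I, ← eta_pullback_map k J] at h
    rw [← pullback_map, ← pullback_map,
      le_antisymm ((eta_pullback_le_iff k).1 h.le) ((eta_pullback_le_iff k).1 h.ge)]
  · intro h
    rw [← eta_pullback_map k I, ← eta_pullback_map k J, pullback_map, pullback_map, h]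

theorem eta_map_eq_iff {I J : TwoSidedIdeal (PiA k n)} :
    eta (I.map (toBar k n)) = eta (J.map (toBar k n)) ↔ eta I = eta J := by
  have key {I J : TwoSidedIdeal (PiA k n)} (h : eta (I.map (toBar k n)) = eta (J.map (toBar k n))) :
      eta I ≤ eta J := by
    rw [← eta_pullback_map k I, ← eta_pullback_map k J]
    refine eta_le_eta_iff.2 fun T U hTU => ?_
    rw [eta_pullback_rel_iff] at hTU ⊢
    rwa [← h]
  refine ⟨fun h => le_antisymm (key h) (key h.symm), fun h => ?_⟩
  have h' := (eta_eq_iff_sup_eq k).1 h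
  rw [← pullback_map, ← pullback_map] at h'
  -- The congruence of the preimage determines the ideal, so the two image ideals are themselves
  -- equal.
  rw [le_antisymm ((eta_pullback_le_iff k).1 (congrArg eta h').le)
    ((eta_pullback_le_iff k).1 (congrArg eta h').ge)]

theorem ofPath_mem_sup_iff (I : TwoSidedIdeal (PiA k n)) (p : PathsA n) :
    ofPath k n p ∈ I ⊔ cycIdeal k n ↔ ofPath k n p ∈ I := by
  rw [ofPath_eq]
  exact ⟨word_mem_of_mem_sup k, fun h => le_sup_left (a := I) h⟩

theorem sup_eq_iff_inter_eq {I J : TwoSidedIdeal (PiA k n)} :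
    I ⊔ cycIdeal k n = J ⊔ cycIdeal k n ↔
      (I : Set (PiA k n)) ∩ Set.range (ofPath k n) =
        (J : Set (PiA k n)) ∩ Set.range (ofPath k n) := by
  constructor
  · intro h
    ext x
    refine and_congr_left ?_
    rintro ⟨p, rfl⟩
    rw [SetLike.mem_coe, SetLike.mem_coe, ← ofPath_mem_sup_iff, h, ofPath_mem_sup_iff]
  · intro h
    have key (p : PathsA n) : ofPath k n p ∈ I ⊔ cycIdeal k n ↔ ofPath k n p ∈ J ⊔ cycIdeal k n := by
      rw [ofPath_mem_sup_iff, ofPath_mem_sup_iff]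
      have hp := Set.ext_iff.1 h (ofPath k n p)
      exact ⟨fun hI => (hp.1 ⟨hI, p, rfl⟩).1, fun hJ => (hp.2 ⟨hJ, p, rfl⟩).1⟩
    refine TwoSidedIdeal.ext fun x => ?_
    rw [mem_iff_of_cycIdeal_le k le_sup_right, mem_iff_of_cycIdeal_le k le_sup_right]
    exact forall₂_congr fun i j => imp_congr_right fun _ => key (geodesicPath i j)

end PiA

/-! ### The theorem -/

theorem mainTheorem10 (k : Type u) [Field k] (n : ℕ) (hn : 1 ≤ n) :
    -- (a)
    brickIdeal (PiA k n) = PiA.cycIdeal k n ∧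
    -- (b), first isomorphism: `UpperSet` is ordered by reverse inclusion, its dual by inclusion
    (∃ Ψ : (UpperSet (PathsA n))ᵒᵈ ≃o TwoSidedIdeal (PiABar k n),
      ∀ S : UpperSet (PathsA n),
        (Ψ (OrderDual.toDual S) : Set (PiABar k n)) =
          Submodule.span k
            ((fun p => PiA.toBar k n (PiA.ofPath k n p)) '' (S : Set (PathsA n)))) ∧
    -- (b), second isomorphism, through the identification `ρ` of `tors Π` with `tors (Π / I_cyc)`
    (∃ ρ : TorsionClass (PiA k n) ≃o TorsionClass (PiABar k n),
      (∀ T, ρ T = T.restrict (PiA.toBar k n)) ∧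
      ∃ Φ : TwoSidedIdeal (PiABar k n) ≃o AlgCon (PiA k n),
        ∀ (I : TwoSidedIdeal (PiABar k n)) (T U : TorsionClass (PiA k n)),
          (Φ I).1.r T U ↔ (eta I).r (ρ T) (ρ U)) ∧
    -- (c)
    (∀ I J : TwoSidedIdeal (PiA k n),
      List.TFAE [
        eta I = eta J,
        eta (I.map (PiA.toBar k n)) = eta (J.map (PiA.toBar k n)),
        I ⊔ PiA.cycIdeal k n = J ⊔ PiA.cycIdeal k n,
        (I : Set (PiA k n)) ∩ Set.range (PiA.ofPath k n) =
          (J : Set (PiA k n)) ∩ Set.range (PiA.ofPath k n)]) := by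
  refine ⟨PiA.brickIdeal_eq k n, ⟨(PiA.idealEquiv k n).symm, fun S => ?_⟩,
    ⟨PiA.torsEquiv k n, fun T => rfl, PiA.algConEquiv k n, fun I T U =>
      PiA.eta_pullback_rel_iff k I T U⟩, fun I J => ?_⟩
  · have h : PiA.upperSetOfIdeal k ((PiA.idealEquiv k n).symm (OrderDual.toDual S)) = S :=
      congrArg OrderDual.ofDual ((PiA.idealEquiv k n).apply_symm_apply (OrderDual.toDual S))
    rw [PiA.coe_eq_span, h]
  · tfae_have 1 ↔ 3 := PiA.eta_eq_iff_sup_eq k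
    tfae_have 2 ↔ 1 := PiA.eta_map_eq_iff k
    tfae_have 3 ↔ 4 := PiA.sup_eq_iff_inter_eq k
    tfae_finish
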